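/- All graphs are finite, undirected and simple unless said otherwise. A class of graphs is \emph{hereditary} if it is closed under isomorphism and under taking induced subgraphs. The \emph{clique-width} of a non-empty graph is the minimum number of labels needed to construct it by means of four operations: creating a vertex with a label $i$; taking the disjoint union of two labelled graphs; adding all edges between vertices labelled $i$ and vertices labelled $j$ (where $i\neq j$); and renaming label $i$ to label $j$. The \emph{linear clique-width} is the minimum number of labels when, in addition, in every disjoint union at least one of the two operands is a single vertex. A hereditary class is a \emph{minimal hereditary class of unbounded (linear) clique-width} if (linear) clique-width is unbounded on it but bounded on each of its proper hereditary subclasses. For an infinite binary word $\alpha=\alpha_1\alpha_2\ldots$ let ${\cal P}^{\alpha}$ be the infinite graph with vertices $v_{i,j}$, $i,j\ge 1$, in which $v_{i,j}$ and $v_{i',j+1}$ are adjacent if and only if either $\alpha_j=0$ and $i=i'$, or $\alpha_j=1$ and $i\neq i'$, and there are no other edges. Let ${\cal G}_\alpha$ be the class of all finite graphs that are isomorphic to an induced subgraph of ${\cal P}^{\alpha}$. For an integer $n\ge 0$ let $\alpha^{(n)}=(0^n1)^\infty$. \textbf{Theorem.} There are infinitely many minimal hereditary classes of graphs of unbounded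 clique-width, and infinitely many minimal hereditary classes of graphs of unbounded linear clique-width. More precisely: (1) for every $n\ge 0$ the class ${\cal G}_{\alpha^{(n)}}$ is both a minimal hereditary class of unbounded clique-width and a minimal hereditary class of unbounded linear clique-width; (2) the classes ${\cal G}_{\alpha^{(n)}}$, $n\ge 0$, are pairwise distinct; (3) for every $n\ge 0$ the class ${\cal G}_{\alpha^{(n)}}$ contains the cycle $C_{2(n+2)}$, and for all $m>n\ge 2$ the class ${\cal G}_{\alpha^{(m)}}$ does not contain $C_{2(n+2)}$. -/

import Mathlib

/-! ### Clique-width and linear clique-width -/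

/-- Algebraic `k`-expressions (labels are the elements of `Fin k`), read as rooted trees:
creation of a vertex with a label, disjoint union, joining the vertices labelled `i` to the
vertices labelled `j` (for `i ≠ j`), and renaming label `i` to label `j`. -/
inductive CWExpr (k : ℕ) : Type
  | vertex (i : Fin k) : CWExpr k
  | union (s t : CWExpr k) : CWExpr k
  | join (i j : Fin k) (hij : i ≠ j) (s : CWExpr k) : CWExpr k
  | rename (i j : Fin k) (s : CWExpr k) : CWExpr k

namespace CWExpr

variable {k : ℕ}

/-- The vertex set of the labelled graph defined by an expression. -/
def Verts : CWExpr k → Type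
  | vertex _ => Unit
  | union s t => s.Verts ⊕ t.Verts
  | join _ _ _ s => s.Verts
  | rename _ _ s => s.Verts

/-- The labels of the vertices of the labelled graph defined by an expression. -/
def label : (e : CWExpr k) → e.Verts → Fin k
  | vertex i => fun _ => i
  | union s t => Sum.elim s.label t.label
  | join _ _ _ s => s.label
  | rename i j s => fun v => if s.label v = i then j else s.label v

/-- The graph defined by an expression. -/
def graph : (e : CWExpr k) → SimpleGraph e.Verts
  | vertex _ => (⊥ : SimpleGraph Unit)
  | union s t => SimpleGraph.sum s.graph t.graph
  | join i j _ s => s.graph ⊔ SimpleGraph.fromRel (fun u v => s.label u = i ∧ s.label v = j)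
  | rename _ _ s => s.graph

/-- The expression creates a single vertex (its tree is a single leaf). -/
def IsLeaf : CWExpr k → Prop
  | vertex _ => True
  | union _ _ => False
  | join _ _ _ s => s.IsLeaf
  | rename _ _ s => s.IsLeaf

/-- The expression is linear, i.e. its tree is a (rooted) caterpillar: in every disjoint union
one of the two operands is a single leaf. -/
def IsLinear : CWExpr k → Prop
  | vertex _ => True
  | union s t => (s.IsLinear ∧ t.IsLeaf) ∨ (s.IsLeaf ∧ t.IsLinear)
  | join _ _ _ s => s.IsLinear
  | rename _ _ s => s.IsLinear

/-- The expression defines `G` (up to isomorphism, forgetting the labels). -/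
def Defines {V : Type} (e : CWExpr k) (G : SimpleGraph V) : Prop :=
  Nonempty (G ≃g e.graph)

end CWExpr

/-- The clique-width of a finite graph: the minimum `k` such that some `k`-expression defines it
(and `0` for the graph without vertices, which no expression defines). -/
noncomputable def cliqueWidth {V : Type} (G : SimpleGraph V) : ℕ :=
  sInf {k : ℕ | ∃ e : CWExpr k, e.Defines G}

/-- The linear clique-width of a finite graph: the minimum `k` such that some linear
`k`-expression defines it (and `0` for the graph without vertices). -/
noncomputable def linearCliqueWidth {V : Type} (G : SimpleGraph V) : ℕ :=
  sInf {k : ℕ | ∃ e : CWExpr k, e.IsLinear ∧ e.Defines G}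

theorem CWExpr.exists_edgeless {k : ℕ} (m : ℕ) (f : Fin (m + 1) → Fin k) :
    ∃ e : CWExpr k, e.IsLinear ∧ e.graph = ⊥ ∧
      ∃ φ : Fin (m + 1) ≃ e.Verts, ∀ v, e.label (φ v) = f v := by
  induction m with
  | zero =>
    refine ⟨.vertex (f 0), trivial, rfl, (Equiv.equivPUnit (Fin 1) : Fin 1 ≃ Unit), ?_⟩
    intro v
    fin_cases v
    rfl
  | succ m ih =>
    obtain ⟨e, hl, hb, φ, hφ⟩ := ih (fun v => f v.castSucc)
    refine ⟨.union e (.vertex (f (Fin.last _))), Or.inl ⟨hl, trivial⟩, ?_,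
      ((finSumFinEquiv (m := m + 1) (n := 1)).symm.trans
        (Equiv.sumCongr φ (Equiv.equivPUnit (Fin 1))) : Fin (m + 1 + 1) ≃ e.Verts ⊕ Unit), ?_⟩
    · change SimpleGraph.sum e.graph (⊥ : SimpleGraph Unit) = ⊥
      ext a b
      rcases a with a | a <;> rcases b with b | b <;> simp [hb]
    · intro v
      change Sum.elim e.label (fun _ => f (Fin.last _)) (Sum.map φ (Equiv.equivPUnit (Fin 1))
        ((finSumFinEquiv (m := m + 1) (n := 1)).symm v)) = f v
      induction v using Fin.lastCases with
      | last =>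
        have : (finSumFinEquiv (m := m + 1) (n := 1)).symm (Fin.last (m + 1)) = Sum.inr 0 := by
          rw [Equiv.symm_apply_eq]; rfl
        rw [this]; rfl
      | cast v =>
        have : (finSumFinEquiv (m := m + 1) (n := 1)).symm v.castSucc = Sum.inl v := by
          rw [Equiv.symm_apply_eq]; rfl
        rw [this]; exact hφ v

theorem CWExpr.exists_edges {k : ℕ} (m : ℕ) (f : Fin (m + 1) → Fin k)
    (hf : Function.Injective f) (l : List (Fin (m + 1) × Fin (m + 1))) :
    ∃ e : CWExpr k, e.IsLinear ∧
      ∃ φ : Fin (m + 1) ≃ e.Verts, (∀ v, e.label (φ v) = f v) ∧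
        ∀ a b, e.graph.Adj (φ a) (φ b) ↔ a ≠ b ∧ ((a, b) ∈ l ∨ (b, a) ∈ l) := by
  induction l with
  | nil =>
    obtain ⟨e, hl, hb, φ, hφ⟩ := CWExpr.exists_edgeless m f
    exact ⟨e, hl, φ, hφ, fun a b => by simp [hb]⟩
  | cons p l ih =>
    obtain ⟨u, v⟩ := p
    obtain ⟨e, hl, φ, hφ, hadj⟩ := ih
    by_cases huv : u = v
    · subst huv
      refine ⟨e, hl, φ, hφ, fun a b => ?_⟩
      rw [hadj]
      simp only [List.mem_cons, Prod.mk.injEq]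
      grind
    · refine ⟨.join (f u) (f v) (fun h => huv (hf h)) e, hl, φ, hφ, fun a b => ?_⟩
      change e.graph.Adj (φ a) (φ b) ∨ (φ a ≠ φ b ∧
        ((e.label (φ a) = f u ∧ e.label (φ b) = f v) ∨
          (e.label (φ b) = f u ∧ e.label (φ a) = f v))) ↔ _
      rw [hadj, hφ, hφ, hf.eq_iff, hf.eq_iff, hf.eq_iff, hf.eq_iff, φ.injective.ne_iff]
      simp only [List.mem_cons, Prod.mk.injEq]
      grind

/-- Every graph on `m + 1` vertices is defined by a linear `(m + 1)`-expression, so that the two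
minima above are attained for every finite graph with at least one vertex. -/
theorem CWExpr.exists_linear_defines {m : ℕ} (G : SimpleGraph (Fin (m + 1))) :
    ∃ e : CWExpr (m + 1), e.IsLinear ∧ e.Defines G := by
  classical
  obtain ⟨e, hl, φ, -, hadj⟩ := CWExpr.exists_edges m id Function.injective_id
    ((Finset.univ.filter fun p : Fin (m + 1) × Fin (m + 1) => G.Adj p.1 p.2).toList)
  refine ⟨e, hl, ⟨⟨φ, ?_⟩⟩⟩
  intro a b
  rw [hadj]
  simp only [Finset.mem_toList, Finset.mem_filter, Finset.mem_univ, true_and]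
  constructor
  · rintro ⟨-, h | h⟩
    exacts [h, h.symm]
  · exact fun h => ⟨h.ne, Or.inl h⟩

/-! ### Hereditary graph classes -/

/-- Finite graphs, with vertex set `{0, …, n - 1}`. -/
abbrev FinGraph : Type := Σ n : ℕ, SimpleGraph (Fin n)

/-- A class of finite graphs is hereditary if it is closed under taking induced subgraphs
(up to isomorphism; in particular it is closed under isomorphism). -/
def IsHereditary (X : Set FinGraph) : Prop :=
  ∀ G ∈ X, ∀ H : FinGraph, Nonempty (H.2 ↪g G.2) → H ∈ X

/-- The graph parameter `w` is unbounded on the class `X`. -/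
def IsUnbounded (w : FinGraph → ℕ) (X : Set FinGraph) : Prop :=
  ∀ k : ℕ, ∃ G ∈ X, k < w G

/-- `X` is a minimal hereditary class on which the parameter `w` is unbounded: `w` is unbounded
on `X`, and bounded on every proper hereditary subclass of `X`. -/
def IsMinimalHereditaryUnbounded (w : FinGraph → ℕ) (X : Set FinGraph) : Prop :=
  IsHereditary X ∧ IsUnbounded w X ∧ ∀ Y : Set FinGraph, IsHereditary Y → Y ⊂ X → ¬ IsUnbounded w Y

/-- `X` is a minimal hereditary class of graphs of unbounded clique-width. -/
def IsMinimalUnboundedCliqueWidth (X : Set FinGraph) : Prop :=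
  IsMinimalHereditaryUnbounded (fun G => cliqueWidth G.2) X

/-- `X` is a minimal hereditary class of graphs of unbounded linear clique-width. -/
def IsMinimalUnboundedLinearCliqueWidth (X : Set FinGraph) : Prop :=
  IsMinimalHereditaryUnbounded (fun G => linearCliqueWidth G.2) X

/-! ### The classes defined by infinite binary words -/

/-- The infinite graph `𝒫`, a disjoint union of infinite paths, one for each row. The vertex
`(i, j)` lies in row `i` and column `j`; rows and columns are counted from `0`. -/
def baseGraph : SimpleGraph (ℕ × ℕ) where
  Adj u v := u.1 = v.1 ∧ (u.2 + 1 = v.2 ∨ v.2 + 1 = u.2)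
  symm := ⟨fun _ _ h => ⟨h.1.symm, h.2.symm⟩⟩
  loopless := ⟨fun _ h => by omega⟩

/-- The graph `𝒫^α`: the edges of `𝒫` between the consecutive columns `j` and `j + 1` are
complemented (bipartitely) if and only if the letter `α j` is `1` (that is, `true`). -/
def wordGraph (α : ℕ → Bool) : SimpleGraph (ℕ × ℕ) where
  Adj u v :=
    (u.2 + 1 = v.2 ∧ Xor (baseGraph.Adj u v) (α u.2 = true)) ∨
    (v.2 + 1 = u.2 ∧ Xor (baseGraph.Adj v u) (α v.2 = true))
  symm := ⟨fun _ _ h => h.symm⟩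
  loopless := ⟨fun _ h => by omega⟩

/-- The class `𝒢_α` of all finite induced subgraphs of `𝒫^α`. -/
def wordClass (α : ℕ → Bool) : Set FinGraph :=
  {G | Nonempty (G.2 ↪g wordGraph α)}

/-- The infinite periodic word `α^{(n)} = (0^n 1)^∞` (letters are counted from `0`). -/
def zerosOneWord (n : ℕ) : ℕ → Bool :=
  fun j => decide (j % (n + 1) = n)

/-!
The lower bound. The subexpressions of a `k`-expression yield a cut of the defined graph into two
parts with at least a third of the vertices each, across which one part has at most `k`
neighbourhoods (`CWExpr.Defines.exists_balanced_cut`). A large grid of cells in `𝒫^α`, with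
`α = (0^n 1)^∞`, has no such cut (`not_balanced_cut`). Call the gap between two consecutive columns
active if one of its edges is cut. There are at most `3 * k` active gaps, as active gaps that are
far apart need different labels. So some gap with the letter `1` is inactive, and next to it
there is a monochromatic column. The colour it lacks meets a third of the rows; each of
these changes colour at one of the few active gaps, and the rows that do so at the same gap and in
the same direction need pairwise different labels.

The upper bound. A graph with a vertex ordering all of whose initial segments have few
neighbourhoods outside themselves has small linear clique-width
(`linearCliqueWidth_le_of_ordering`). Let a hereditary subclass miss an induced subgraph `H` of
`𝒫^α`, and divide the columns into blocks, of a width that is a multiple of the period and large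
enough for `H`. A graph of the subclass then occupies only a bounded number of rows of any block
completely, as `H` can be found in the full rows of a block (`exists_embedding_of_fullRows`). All
other rows have a hole in the block, so that up to boundedly many exceptions per block the
horizontal segments between holes are short; creating these segments one after the other, from left
to right, is the required ordering (`linearCliqueWidth_le_of_fullRows`).

Since the clique-width is at most the linear clique-width, both bounds serve both parameters.

The classes. An induced cycle of length at least eight turns back at letters `1`; if these are
different letters, they are at least `n + 1` columns apart and the cycle is long. This separates the
classes with `n ≥ 2`. The graphs given by a few rows and the letters `11` or `101` single out the
classes with `n = 0` and `n = 1`: the bipartite complement of a matching has to sit at a single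
letter `1` unless two such letters are consecutive (`isOneGap_of_coMatching`).
-/

/-! ### Balanced cuts of algebraic expressions -/

instance CWExpr.finite_verts {k : ℕ} : (e : CWExpr k) → Finite e.Verts
  | vertex _ => inferInstanceAs (Finite Unit)
  | union s t =>
    have := s.finite_verts
    have := t.finite_verts
    inferInstanceAs (Finite (s.Verts ⊕ t.Verts))
  | join _ _ _ s => s.finite_verts
  | rename _ _ s => s.finite_verts

instance CWExpr.nonempty_verts {k : ℕ} : (e : CWExpr k) → Nonempty e.Verts
  | vertex _ => ⟨()⟩
  | union s _ => s.nonempty_verts.map Sum.inl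
  | join _ _ _ s => s.nonempty_verts
  | rename _ _ s => s.nonempty_verts

/-- The vertex set `S` of a subexpression of intermediate size: the labels that its vertices carry
in the subexpression determine their neighbourhoods outside `S`. The clause on `e.label` says that
labels merge but never split on the way up to `e`; it keeps the induction going. -/
theorem CWExpr.exists_balanced_cut {k : ℕ} (e : CWExpr k) (t : ℕ) (ht : 1 ≤ t)
    (h : t < Nat.card e.Verts) :
    ∃ S : Set e.Verts, S.ncard ≤ t ∧ t < 2 * S.ncard ∧ ∃ lab : e.Verts → Fin k,
      ∀ u ∈ S, ∀ v ∈ S, lab u = lab v →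
        e.label u = e.label v ∧ ∀ w ∉ S, (e.graph.Adj u w ↔ e.graph.Adj v w) := by
  induction e with
  | vertex i =>
    have : Nat.card (CWExpr.vertex i).Verts = 1 := Nat.card_unique (α := Unit)
    omega
  | union s t' ihs iht =>
    have hc : Nat.card (CWExpr.union s t').Verts = Nat.card s.Verts + Nat.card t'.Verts :=
      Nat.card_sum (α := s.Verts) (β := t'.Verts)
    have hl : (Set.range (Sum.inl : s.Verts → s.Verts ⊕ t'.Verts)).ncard = Nat.card s.Verts := by
      rw [← Set.image_univ, Set.ncard_image_of_injective _ Sum.inl_injective, Set.ncard_univ]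
    have hr : (Set.range (Sum.inr : t'.Verts → s.Verts ⊕ t'.Verts)).ncard = Nat.card t'.Verts := by
      rw [← Set.image_univ, Set.ncard_image_of_injective _ Sum.inr_injective, Set.ncard_univ]
    by_cases h1 : t < Nat.card s.Verts
    · obtain ⟨S, hS1, hS2, lab, hlab⟩ := ihs h1
      refine ⟨(Sum.inl '' S : Set (s.Verts ⊕ t'.Verts)), ?_, ?_,
        (Sum.elim lab t'.label : s.Verts ⊕ t'.Verts → Fin k), ?_⟩
      · exact (Set.ncard_image_of_injective S Sum.inl_injective).trans_le hS1
      · exact hS2.trans_eq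
          (congrArg (2 * ·) (Set.ncard_image_of_injective S Sum.inl_injective).symm)
      · rintro _ ⟨u, hu, rfl⟩ _ ⟨v, hv, rfl⟩ huv
        obtain ⟨h3, h4⟩ := hlab u hu v hv huv
        refine ⟨h3, ?_⟩
        rintro (w | w) hw
        · exact h4 w fun h => hw ⟨w, h, rfl⟩
        · exact Iff.rfl
    · by_cases h2 : t < Nat.card t'.Verts
      · obtain ⟨S, hS1, hS2, lab, hlab⟩ := iht h2
        refine ⟨(Sum.inr '' S : Set (s.Verts ⊕ t'.Verts)), ?_, ?_,
          (Sum.elim s.label lab : s.Verts ⊕ t'.Verts → Fin k), ?_⟩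
        · exact (Set.ncard_image_of_injective S Sum.inr_injective).trans_le hS1
        · exact hS2.trans_eq
            (congrArg (2 * ·) (Set.ncard_image_of_injective S Sum.inr_injective).symm)
        · rintro _ ⟨u, hu, rfl⟩ _ ⟨v, hv, rfl⟩ huv
          obtain ⟨h3, h4⟩ := hlab u hu v hv huv
          refine ⟨h3, ?_⟩
          rintro (w | w) hw
          · exact Iff.rfl
          · exact h4 w fun h => hw ⟨w, h, rfl⟩
      · rcases le_total (Nat.card t'.Verts) (Nat.card s.Verts) with h3 | h3
        · refine ⟨(Set.range Sum.inl : Set (s.Verts ⊕ t'.Verts)), hl.trans_le (by omega),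
            lt_of_lt_of_eq (b := 2 * Nat.card s.Verts) (by omega) (congrArg (2 * ·) hl.symm),
            (Sum.elim s.label t'.label : s.Verts ⊕ t'.Verts → Fin k), ?_⟩
          rintro _ ⟨u, rfl⟩ _ ⟨v, rfl⟩ huv
          refine ⟨huv, ?_⟩
          rintro (w | w) hw
          · exact absurd ⟨w, rfl⟩ hw
          · exact Iff.rfl
        · refine ⟨(Set.range Sum.inr : Set (s.Verts ⊕ t'.Verts)), hr.trans_le (by omega),
            lt_of_lt_of_eq (b := 2 * Nat.card t'.Verts) (by omega) (congrArg (2 * ·) hr.symm),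
            (Sum.elim s.label t'.label : s.Verts ⊕ t'.Verts → Fin k), ?_⟩
          rintro _ ⟨u, rfl⟩ _ ⟨v, rfl⟩ huv
          refine ⟨huv, ?_⟩
          rintro (w | w) hw
          · exact Iff.rfl
          · exact absurd ⟨w, rfl⟩ hw
  | join i j hij s ih =>
    obtain ⟨S, hS1, hS2, lab, hlab⟩ := ih h
    refine ⟨S, hS1, hS2, lab, fun u hu v hv huv => ?_⟩
    obtain ⟨h3, h4⟩ := hlab u hu v hv huv
    refine ⟨h3, fun w hw => ?_⟩
    have hu' : u ≠ w := fun h => hw (h ▸ hu)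
    have hv' : v ≠ w := fun h => hw (h ▸ hv)
    change s.graph.Adj u w ∨ (u ≠ w ∧ ((s.label u = i ∧ s.label w = j) ∨
        (s.label w = i ∧ s.label u = j))) ↔
      s.graph.Adj v w ∨ (v ≠ w ∧ ((s.label v = i ∧ s.label w = j) ∨
        (s.label w = i ∧ s.label v = j)))
    rw [h4 w hw, h3]
    simp only [ne_eq, hu', hv', not_false_eq_true]
  | rename i j s ih =>
    obtain ⟨S, hS1, hS2, lab, hlab⟩ := ih h
    refine ⟨S, hS1, hS2, lab, fun u hu v hv huv => ?_⟩
    obtain ⟨h3, h4⟩ := hlab u hu v hv huv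
    refine ⟨?_, h4⟩
    change (if s.label u = i then j else s.label u) = if s.label v = i then j else s.label v
    rw [h3]

/-- The cut of `CWExpr.exists_balanced_cut`, transported to the graph defined by the expression. -/
theorem CWExpr.Defines.exists_balanced_cut {k : ℕ} {V : Type} {G : SimpleGraph V} {e : CWExpr k}
    (he : e.Defines G) (t : ℕ) (ht : 1 ≤ t) (h : t < Nat.card V) :
    ∃ S : Set V, S.ncard ≤ t ∧ t < 2 * S.ncard ∧ ∃ lab : V → Fin k,
      ∀ u ∈ S, ∀ v ∈ S, lab u = lab v → ∀ w ∉ S, (G.Adj u w ↔ G.Adj v w) := by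
  obtain ⟨φ⟩ := he
  rw [Nat.card_congr φ.toEquiv] at h
  obtain ⟨S, hS1, hS2, lab, hlab⟩ := e.exists_balanced_cut t ht h
  have hS : (φ ⁻¹' S).ncard = S.ncard :=
    Set.ncard_preimage_of_injective_subset_range φ.injective
      fun x _ => φ.surjective x
  refine ⟨φ ⁻¹' S, hS ▸ hS1, hS ▸ hS2, lab ∘ φ, fun u hu v hv huv w hw => ?_⟩
  rw [← φ.map_adj_iff, ← φ.map_adj_iff (v := v)]
  exact (hlab _ hu _ hv huv).2 _ hw

/-! ### Linear clique-width from vertex orderings -/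

/-- The labelled graph induced by `G` and `ℓ` on the finite vertex set `s` is defined by a linear
`k`-expression. -/
def HasLinearExpr {V : Type} {k : ℕ} (G : SimpleGraph V) (s : Finset V) (ℓ : V → Fin k) : Prop :=
  ∃ e : CWExpr k, e.IsLinear ∧ ∃ φ : s ≃ e.Verts,
    (∀ a b, e.graph.Adj (φ a) (φ b) ↔ G.Adj a b) ∧ ∀ a, e.label (φ a) = ℓ a

namespace HasLinearExpr

variable {V : Type} {k : ℕ} {G : SimpleGraph V} {s : Finset V} {ℓ : V → Fin k}

theorem congr {G' : SimpleGraph V} {ℓ' : V → Fin k} (h : HasLinearExpr G s ℓ)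
    (hG : ∀ a ∈ s, ∀ b ∈ s, (G.Adj a b ↔ G'.Adj a b)) (hl : ∀ a ∈ s, ℓ a = ℓ' a) :
    HasLinearExpr G' s ℓ' := by
  obtain ⟨e, he, φ, h1, h2⟩ := h
  exact ⟨e, he, φ, fun a b => (h1 a b).trans (hG a a.2 b b.2), fun a => (h2 a).trans (hl a a.2)⟩

theorem singleton (G : SimpleGraph V) (v : V) (ℓ : V → Fin k) : HasLinearExpr G {v} ℓ := by
  refine ⟨.vertex (ℓ v), trivial, (Equiv.ofUnique _ Unit : ({v} : Finset V) ≃ Unit), ?_, ?_⟩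
  · intro a b
    have ha := Finset.mem_singleton.1 a.2
    have hb := Finset.mem_singleton.1 b.2
    rw [ha, hb]
    exact iff_of_false (fun h => h) (G.irrefl)
  · intro a
    rw [Finset.mem_singleton.1 a.2]
    rfl

theorem rename (h : HasLinearExpr G s ℓ) (i j : Fin k) :
    HasLinearExpr G s (fun v => if ℓ v = i then j else ℓ v) := by
  obtain ⟨e, he, φ, h1, h2⟩ := h
  refine ⟨.rename i j e, he, φ, h1, fun a => ?_⟩
  change (if e.label (φ a) = i then j else e.label (φ a)) = _
  rw [h2]

theorem join (h : HasLinearExpr G s ℓ) {i j : Fin k} (hij : i ≠ j) :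
    HasLinearExpr (G ⊔ SimpleGraph.fromRel (fun u v => ℓ u = i ∧ ℓ v = j)) s ℓ := by
  obtain ⟨e, he, φ, h1, h2⟩ := h
  refine ⟨.join i j hij e, he, φ, fun a b => ?_, h2⟩
  change e.graph.Adj (φ a) (φ b) ∨ (φ a ≠ φ b ∧
        ((e.label (φ a) = i ∧ e.label (φ b) = j) ∨
          (e.label (φ b) = i ∧ e.label (φ a) = j))) ↔ _
  rw [h1, h2, h2, φ.injective.ne_iff]
  simp only [SimpleGraph.sup_adj, SimpleGraph.fromRel_adj, ne_eq, Subtype.ext_iff]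

theorem join_finset (h : HasLinearExpr G s ℓ) {i : Fin k} (T : Finset (Fin k)) (hi : i ∉ T) :
    HasLinearExpr (G ⊔ SimpleGraph.fromRel (fun u v => ℓ u = i ∧ ℓ v ∈ T)) s ℓ := by
  induction T using Finset.induction_on with
  | empty => exact h.congr (fun a _ b _ => by simp) (fun _ _ => rfl)
  | insert j T hj ih =>
    rw [Finset.mem_insert, not_or] at hi
    refine ((ih hi.2).join hi.1).congr (fun a _ b _ => ?_) (fun _ _ => rfl)
    simp only [SimpleGraph.sup_adj, SimpleGraph.fromRel_adj, Finset.mem_insert]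
    tauto

theorem insert_isolated [DecidableEq V] (h : HasLinearExpr G s ℓ) {v : V} (hv : v ∉ s)
    (hG : ∀ a ∈ s, ¬ G.Adj a v) : HasLinearExpr G (insert v s) ℓ := by
  obtain ⟨e, he, φ, h1, h2⟩ := h
  let ψ : (insert v s : Finset V) ≃ e.Verts ⊕ Unit :=
    (Finset.subtypeInsertEquivOption hv).trans
      ((Equiv.optionEquivSumPUnit _).trans (Equiv.sumCongr φ (Equiv.refl _)))
  have hψ : ∀ a : (insert v s : Finset V), (a.1 = v ∧ ψ a = Sum.inr ()) ∨
      ∃ h : a.1 ∈ s, ψ a = Sum.inl (φ ⟨a.1, h⟩) := by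
    rintro ⟨a, ha⟩
    by_cases hav : a = v
    · subst hav
      left
      simp [ψ, Finset.subtypeInsertEquivOption]
    · right
      refine ⟨(Finset.mem_insert.1 ha).resolve_left hav, ?_⟩
      simp [ψ, Finset.subtypeInsertEquivOption, hav]
  refine ⟨.union e (.vertex (ℓ v)), Or.inl ⟨he, trivial⟩, ψ, fun a b => ?_, fun a => ?_⟩
  · change (SimpleGraph.sum e.graph (⊥ : SimpleGraph Unit)).Adj (ψ a) (ψ b) ↔ _
    rcases hψ a with ⟨ha, ha'⟩ | ⟨ha, ha'⟩ <;> rcases hψ b with ⟨hb, hb'⟩ | ⟨hb, hb'⟩ <;>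
      rw [ha', hb']
    · rw [ha, hb]; simp
    · rw [ha, G.adj_comm]; simpa using hG _ hb
    · rw [hb]; simpa using hG _ ha
    · exact h1 _ _
  · change Sum.elim e.label (fun _ => ℓ v) (ψ a) = _
    rcases hψ a with ⟨ha, ha'⟩ | ⟨ha, ha'⟩ <;> rw [ha']
    · rw [ha]; rfl
    · exact h2 _

/-- Labels can be merged until they separate exactly the classes of a coarser relation. -/
theorem exists_merge (r : V → V → Prop) (hr : Equivalence r) (h : HasLinearExpr G s ℓ)
    (hℓ : ∀ u ∈ s, ∀ v ∈ s, ℓ u = ℓ v → r u v) :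
    ∃ ℓ' : V → Fin k, HasLinearExpr G s ℓ' ∧ ∀ u ∈ s, ∀ v ∈ s, (ℓ' u = ℓ' v ↔ r u v) := by
  induction hn : (s.image ℓ).card using Nat.strong_induction_on generalizing ℓ with
  | _ n ih =>
    by_cases hx : ∀ u ∈ s, ∀ v ∈ s, r u v → ℓ u = ℓ v
    · exact ⟨ℓ, h, fun u hu v hv => ⟨hℓ u hu v hv, hx u hu v hv⟩⟩
    · push Not at hx
      obtain ⟨u, hu, v, hv, huv, hne⟩ := hx
      refine ih _ ?_ (h.rename (ℓ u) (ℓ v)) ?_ rfl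
      · rw [← hn]
        apply Finset.card_lt_card
        rw [Finset.ssubset_iff_of_subset]
        · refine ⟨ℓ u, Finset.mem_image_of_mem _ hu, ?_⟩
          rw [Finset.mem_image]
          rintro ⟨a, -, ha⟩
          split_ifs at ha with h1
          · exact hne ha.symm
          · exact h1 ha
        · intro x hx
          obtain ⟨a, ha, rfl⟩ := Finset.mem_image.1 hx
          split_ifs
          · exact Finset.mem_image_of_mem _ hv
          · exact Finset.mem_image_of_mem _ ha
      · intro a ha b hb hab
        have key : ∀ a ∈ s, ℓ a = ℓ u → r a v := fun a ha h => hr.trans (hℓ a ha u hu h) huv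
        split_ifs at hab with h1 h2 h2
        · exact hr.trans (key a ha h1) (hr.symm (key b hb h2))
        · exact hr.trans (key a ha h1) (hℓ v hv b hb hab)
        · exact hr.trans (hℓ a ha v hv hab) (hr.symm (key b hb h2))
        · exact hℓ a ha b hb hab

end HasLinearExpr

/-- A graph has small linear clique-width if its vertices can be ordered in such a way that the
vertices of each initial segment have few distinct neighbourhoods outside the segment. Vertices
are created in this order, the new one with the one label that is not in use; vertices that have
become indistinguishable from outside get the same label. -/
theorem linearCliqueWidth_le_of_ordering {V ι τ : Type} [Finite V] [LinearOrder ι] [Fintype τ]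
    (G : SimpleGraph V) (K : V → ι) (hK : Function.Injective K)
    (hf : ∀ x : ι, ∃ f : V → τ, ∀ u v w, K u ≤ x → K v ≤ x → x < K w → f u = f v →
      (G.Adj u w ↔ G.Adj v w)) :
    linearCliqueWidth G ≤ Fintype.card τ + 1 := by
  classical
  have := Fintype.ofFinite V
  have main : ∀ s : Finset V, (∀ m ∈ s, ∀ w, K w ≤ K m → w ∈ s) → s.Nonempty →
      ∃ ℓ : V → Fin (Fintype.card τ + 1), HasLinearExpr G s ℓ ∧
        ∀ u ∈ s, ∀ v ∈ s, ℓ u = ℓ v → ∀ w ∉ s, (G.Adj u w ↔ G.Adj v w) := by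
    intro s
    induction s using Finset.induction_on_max_value K with
    | empty => exact fun _ h => absurd h Finset.not_nonempty_empty
    | insert a s has hmax ih =>
      intro hlow _
      rcases s.eq_empty_or_nonempty with rfl | hne
      · refine ⟨fun _ => 0, HasLinearExpr.singleton _ _ _, fun u hu v hv _ w _ => ?_⟩
        simp only [insert_empty_eq, Finset.mem_singleton] at hu hv
        rw [hu, hv]
      have hlow' : ∀ m ∈ s, ∀ w, K w ≤ K m → w ∈ s := by
        intro m hm w hw
        refine (Finset.mem_insert.1 (hlow m (Finset.mem_insert_of_mem hm) w hw)).resolve_left ?_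
        rintro rfl
        exact has (hK (le_antisymm hw (hmax m hm)) ▸ hm)
      obtain ⟨ℓ₀, hℓ₀, hs₀⟩ := ih hlow' hne
      obtain ⟨ℓ, hℓ, hs⟩ := HasLinearExpr.exists_merge
        (fun u v => ∀ w ∉ s, (G.Adj u w ↔ G.Adj v w))
        ⟨fun _ _ _ => Iff.rfl, fun h w hw => (h w hw).symm,
          fun h h' w hw => (h w hw).trans (h' w hw)⟩ hℓ₀ hs₀
      -- fewer labels than available are in use, because exact labels are determined by types
      obtain ⟨c, hc⟩ : ∃ c, c ∉ s.image ℓ := by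
        obtain ⟨m, hm, hmmax⟩ := s.exists_max_image K hne
        obtain ⟨f, hf⟩ := hf (K m)
        have h1 : (s.image ℓ).card ≤ (s.image f).card := by
          refine Finset.card_le_card_of_surjOn
            (fun t => if h : ∃ u ∈ s, f u = t then ℓ h.choose else 0) ?_
          intro x hx
          obtain ⟨u, hu, rfl⟩ := Finset.mem_image.1 (Finset.mem_coe.1 hx)
          have hex : ∃ u' ∈ s, f u' = f u := ⟨u, hu, rfl⟩
          refine ⟨f u, Finset.mem_coe.2 (Finset.mem_image_of_mem _ hu), ?_⟩
          simp only [hex, dite_true]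
          rw [hs _ hex.choose_spec.1 u hu]
          intro w hw
          exact hf _ _ w (hmmax _ hex.choose_spec.1) (hmmax u hu)
            (lt_of_not_ge fun h => hw (hlow' m hm w h)) hex.choose_spec.2
        by_contra! hall
        have h2 : s.image ℓ = Finset.univ := Finset.eq_univ_of_forall hall
        have h3 := (s.image f).card_le_univ
        rw [h2, Finset.card_univ, Fintype.card_fin] at h1
        omega
      have hc' : ∀ u ∈ s, ℓ u ≠ c := fun u hu h => hc (h ▸ Finset.mem_image_of_mem _ hu)
      have hne' : ∀ u ∈ s, u ≠ a := fun u hu h => has (h ▸ hu)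
      let G₀ : SimpleGraph V :=
        { Adj := fun u v => G.Adj u v ∧ u ≠ a ∧ v ≠ a
          symm := ⟨fun _ _ h => ⟨h.1.symm, h.2.2, h.2.1⟩⟩
          loopless := ⟨fun _ h => G.irrefl h.1⟩ }
      have e1 : HasLinearExpr G₀ s (Function.update ℓ a c) :=
        hℓ.congr (fun u hu v hv => ⟨fun h => ⟨h, hne' u hu, hne' v hv⟩, fun h => h.1⟩)
          (fun u hu => by rw [Function.update_of_ne (hne' u hu)])
      have e2 := (e1.insert_isolated has (fun _ _ h => h.2.2 rfl)).join_finset (i := c)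
        ((s.filter fun u => G.Adj u a).image ℓ)
        (fun h => hc (Finset.image_subset_image (Finset.filter_subset _ _) h))
      have hT : ∀ u ∈ s, (ℓ u ∈ (s.filter fun u => G.Adj u a).image ℓ ↔ G.Adj u a) := by
        intro u hu
        rw [Finset.mem_image]
        constructor
        · rintro ⟨v, hv, hvu⟩
          rw [Finset.mem_filter] at hv
          exact ((hs v hv.1 u hu).1 hvu a has).1 hv.2
        · exact fun h => ⟨u, Finset.mem_filter.2 ⟨hu, h⟩, rfl⟩
      have hcT : c ∉ (s.filter fun u => G.Adj u a).image ℓ :=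
        fun h => hc (Finset.image_subset_image (Finset.filter_subset _ _) h)
      refine ⟨Function.update ℓ a c, e2.congr ?_ (fun _ _ => rfl), ?_⟩
      · intro u hu v hv
        rw [Finset.mem_insert] at hu hv
        simp only [SimpleGraph.sup_adj, SimpleGraph.fromRel_adj]
        rcases hu with rfl | hu <;> rcases hv with rfl | hv
        · simp [G₀]
        · rw [Function.update_self, Function.update_of_ne (hne' v hv), hT v hv, G.adj_comm]
          simp [G₀, (hne' v hv).symm, hc' v hv, hcT]
        · rw [Function.update_self, Function.update_of_ne (hne' u hu), hT u hu]
          simp [G₀, hne' u hu, hc' u hu, hcT]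
        · rw [Function.update_of_ne (hne' u hu), Function.update_of_ne (hne' v hv)]
          simp [G₀, hne' u hu, hne' v hv, hc' u hu, hc' v hv]
      · intro u hu v hv huv w hw
        rw [Finset.mem_insert] at hu hv
        rw [Finset.mem_insert, not_or] at hw
        rcases hu with rfl | hu <;> rcases hv with rfl | hv
        · rfl
        · rw [Function.update_self, Function.update_of_ne (hne' v hv)] at huv
          exact absurd huv.symm (hc' v hv)
        · rw [Function.update_self, Function.update_of_ne (hne' u hu)] at huv
          exact absurd huv (hc' u hu)
        · rw [Function.update_of_ne (hne' u hu), Function.update_of_ne (hne' v hv)] at huv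
          exact (hs u hu v hv).1 huv w hw.2
  rcases isEmpty_or_nonempty V with hV | hV
  · have : {k : ℕ | ∃ e : CWExpr k, e.IsLinear ∧ e.Defines G} = ∅ := by
      rw [Set.eq_empty_iff_forall_notMem]
      rintro k ⟨e, -, ⟨φ⟩⟩
      exact e.nonempty_verts.elim fun x => hV.elim (φ.symm x)
    rw [linearCliqueWidth, this, Nat.sInf_empty]
    exact Nat.zero_le _
  · obtain ⟨ℓ, ⟨e, he, φ, hφ, -⟩, -⟩ := main Finset.univ (fun _ _ _ _ => Finset.mem_univ _)
      Finset.univ_nonempty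
    refine Nat.sInf_le ⟨e, he, ⟨⟨(Equiv.subtypeUnivEquiv Finset.mem_univ).symm.trans φ, ?_⟩⟩⟩
    intro a b
    exact hφ _ _

theorem cliqueWidth_le_linearCliqueWidth {n : ℕ} (G : SimpleGraph (Fin n)) :
    cliqueWidth G ≤ linearCliqueWidth G := by
  rcases n with _ | m
  · have : {k : ℕ | ∃ e : CWExpr k, e.Defines G} = ∅ := by
      rw [Set.eq_empty_iff_forall_notMem]
      rintro k ⟨e, ⟨φ⟩⟩
      exact e.nonempty_verts.elim fun x => (φ.symm x).elim0
    rw [cliqueWidth, this, Nat.sInf_empty]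
    exact Nat.zero_le _
  · obtain ⟨e, -, he⟩ := Nat.sInf_mem (s := {k : ℕ | ∃ e : CWExpr k, e.IsLinear ∧ e.Defines G})
      ⟨m + 1, CWExpr.exists_linear_defines G⟩
    exact Nat.sInf_le ⟨e, he⟩

/-! ### Adjacency in the graphs of binary words -/

theorem wordGraph_adj {α : ℕ → Bool} {u v : ℕ × ℕ} :
    (wordGraph α).Adj u v ↔ (u.2 + 1 = v.2 ∧ (α u.2 = true ↔ u.1 ≠ v.1)) ∨
      (v.2 + 1 = u.2 ∧ (α v.2 = true ↔ u.1 ≠ v.1)) := by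
  simp only [wordGraph, baseGraph, Xor]
  grind

theorem wordGraph_adj_succ {α : ℕ → Bool} {i i' j : ℕ} :
    (wordGraph α).Adj (i, j) (i', j + 1) ↔ (α j = true ↔ i ≠ i') := by
  rw [wordGraph_adj]
  constructor
  · rintro (h | h)
    · exact h.2
    · exact absurd h.1 (by simp only; omega)
  · exact fun h => Or.inl ⟨rfl, h⟩

theorem zerosOneWord_eq_true {n j : ℕ} : zerosOneWord n j = true ↔ j % (n + 1) = n := by
  simp [zerosOneWord]

/-! ### Unboundedness of the clique-width -/

section Unbounded

variable {α : ℕ → Bool} {S : Set (ℕ × ℕ)}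

/-- Some edge between the columns `j` and `j + 1`, within the first `R` rows, leaves or enters
`S`. -/
def IsActiveGap (α : ℕ → Bool) (S : Set (ℕ × ℕ)) (R j : ℕ) : Prop :=
  ∃ i < R, ∃ i' < R, (α j = true ↔ i ≠ i') ∧ ¬ ((i, j) ∈ S ↔ (i', j + 1) ∈ S)

/-- Across an inactive gap every row keeps its colour. For a letter `1` this is because `(i, j)` and
`(i, j + 1)` are joined by a path of length three when there are at least three rows. -/
theorem mem_iff_of_not_isActiveGap {R j i : ℕ} (hR : 3 ≤ R) (h : ¬ IsActiveGap α S R j)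
    (hi : i < R) : ((i, j) ∈ S ↔ (i, j + 1) ∈ S) := by
  have key : ∀ i < R, ∀ i' < R, (α j = true ↔ i ≠ i') → ((i, j) ∈ S ↔ (i', j + 1) ∈ S) := by
    intro i hi i' hi' hα
    by_contra hc
    exact h ⟨i, hi, i', hi', hα, hc⟩
  by_cases hα : α j = true
  · obtain ⟨a, ha, b, hb, hia, hib, hab⟩ :
        ∃ a < R, ∃ b < R, i ≠ a ∧ i ≠ b ∧ a ≠ b := by
      rcases i with _ | _ | i
      · exact ⟨1, by omega, 2, by omega, by omega, by omega, by omega⟩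
      · exact ⟨0, by omega, 2, by omega, by omega, by omega, by omega⟩
      · exact ⟨0, by omega, 1, by omega, by omega, by omega, by omega⟩
    exact (key i hi a ha (by simp [hα, hia])).trans
      ((key b hb a ha (by simp [hα, hab.symm])).symm.trans
        (key b hb i hi (by simp [hα, hib.symm])))
  · exact key i hi i hi (by simp [hα])

/-- A column next to an inactive gap with the letter `1` is monochromatic. -/
theorem mem_iff_mem_of_not_isActiveGap {R j i i' : ℕ} (hR : 3 ≤ R) (h : ¬ IsActiveGap α S R j)
    (hα : α j = true) (hi : i < R) (hi' : i' < R) : ((i, j) ∈ S ↔ (i', j) ∈ S) := by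
  by_cases hii : i = i'
  · rw [hii]
  · rw [mem_iff_of_not_isActiveGap hR h hi]
    by_contra hc
    exact h ⟨i', hi', i, hi, by simp [hα, Ne.symm hii], fun h => hc h.symm⟩

/-- If two cells of a row have different colours, the colour changes between two consecutive
cells. -/
theorem exists_switch {P : ℕ → Prop} {C a b : ℕ} (ha : a < C) (hb : b < C) (h : ¬ (P a ↔ P b)) :
    ∃ j, j + 1 < C ∧ ¬ (P j ↔ P (j + 1)) := by
  by_contra! hc
  have : ∀ j < C, (P 0 ↔ P j) := by
    intro j
    induction j with
    | zero => exact fun _ => Iff.rfl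
    | succ j ih => exact fun hj => (ih (by omega)).trans (hc j hj)
  exact h ((this a ha).symm.trans (this b hb))

variable {k R C : ℕ}

/-- Pairs of vertices across a cut that can be told apart by their own partners bound the number of
labels from below. -/
theorem card_le_of_cut {T : Type} {lab : ℕ × ℕ → Fin k}
    (hlab : ∀ u ∈ S, ∀ v ∈ S, ∀ w ∉ S, u.1 < R → u.2 < C → v.1 < R → v.2 < C → w.1 < R →
      w.2 < C → lab u = lab v → ((wordGraph α).Adj u w ↔ (wordGraph α).Adj v w))
    (F : Finset T) (p : T → (ℕ × ℕ) × (ℕ × ℕ))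
    (hp : ∀ t ∈ F, (p t).1 ∈ S ∧ (p t).2 ∉ S ∧ (p t).1.1 < R ∧ (p t).1.2 < C ∧
      (p t).2.1 < R ∧ (p t).2.2 < C)
    (hne : ∀ t ∈ F, ∀ t' ∈ F, t ≠ t' →
      ¬ ((wordGraph α).Adj (p t).1 (p t).2 ↔ (wordGraph α).Adj (p t').1 (p t).2)) :
    F.card ≤ k := by
  have : F.card ≤ (Finset.univ : Finset (Fin k)).card := by
    refine Finset.card_le_card_of_injOn (fun t => lab (p t).1) (fun _ _ => Finset.mem_univ _) ?_
    intro t ht t' ht' h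
    by_contra hc
    have h1 := hp t ht
    have h2 := hp t' ht'
    exact hne t ht t' ht' hc (hlab _ h1.1 _ h2.1 _ h1.2.1 h1.2.2.1 h1.2.2.2.1 h2.2.2.1
      h2.2.2.2.1 h1.2.2.2.2.1 h1.2.2.2.2.2 h)
  simpa using this

/-- Active gaps at distance at least three need different labels. -/
theorem card_activeGaps_le {lab : ℕ × ℕ → Fin k}
    (hlab : ∀ u ∈ S, ∀ v ∈ S, ∀ w ∉ S, u.1 < R → u.2 < C → v.1 < R → v.2 < C → w.1 < R →
      w.2 < C → lab u = lab v → ((wordGraph α).Adj u w ↔ (wordGraph α).Adj v w))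
    (A : Finset ℕ) (hA : ∀ j ∈ A, j + 1 < C ∧ IsActiveGap α S R j) : A.card ≤ 3 * k := by
  have h1 : A.card ≤ k * (A.image (· % 3)).card := by
    refine Finset.card_le_mul_card_image _ _ fun b _ => ?_
    have hex : ∀ j, ∃ p : (ℕ × ℕ) × (ℕ × ℕ), j ∈ A → p.1 ∈ S ∧ p.2 ∉ S ∧ p.1.1 < R ∧
        p.2.1 < R ∧ (wordGraph α).Adj p.1 p.2 ∧
        (p.1.2 = j ∧ p.2.2 = j + 1 ∨ p.1.2 = j + 1 ∧ p.2.2 = j) := by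
      intro j
      by_cases hj : j ∈ A
      · obtain ⟨-, i, hi, i', hi', hα, hc⟩ := hA j hj
        by_cases hS : (i, j) ∈ S
        · exact ⟨((i, j), (i', j + 1)), fun _ => ⟨hS, fun h => hc (iff_of_true hS h), hi, hi',
            wordGraph_adj_succ.2 hα, Or.inl ⟨rfl, rfl⟩⟩⟩
        · refine ⟨((i', j + 1), (i, j)), fun _ => ⟨?_, hS, hi', hi,
            (wordGraph_adj_succ.2 hα).symm, Or.inr ⟨rfl, rfl⟩⟩⟩
          by_contra h
          exact hc (iff_of_false hS h)
      · exact ⟨default, fun h => absurd h hj⟩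
    choose p hp using hex
    refine card_le_of_cut hlab _ p ?_ ?_
    · intro j hj
      have hj' := (Finset.mem_filter.1 hj).1
      have h1 := (hA j hj').1
      obtain ⟨h2, h3, h4, h5, -, h6⟩ := hp j hj'
      exact ⟨h2, h3, h4, by omega, h5, by omega⟩
    · intro j hj j' hj' hne
      rw [Finset.mem_filter] at hj hj'
      obtain ⟨-, -, -, -, h1, h2⟩ := hp j hj.1
      obtain ⟨-, -, -, -, -, h3⟩ := hp j' hj'.1
      rw [not_iff]
      refine iff_of_false (fun h => h h1) fun h => ?_
      rw [wordGraph_adj] at h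
      omega
  have h2 : (A.image (· % 3)).card ≤ 3 := by
    refine (Finset.card_le_card (t := Finset.range 3) ?_).trans_eq (Finset.card_range 3)
    intro x hx
    obtain ⟨y, -, rfl⟩ := Finset.mem_image.1 hx
    exact Finset.mem_range.2 (Nat.mod_lt _ (by norm_num))
  calc A.card ≤ k * (A.image (· % 3)).card := h1
    _ ≤ k * 3 := Nat.mul_le_mul_left _ h2
    _ = 3 * k := Nat.mul_comm _ _

/-- Rows that switch colour at the same gap and in the same direction need different labels: their
cut pairs form a matching or the bipartite complement of a matching. -/
theorem card_switching_rows_le {lab : ℕ × ℕ → Fin k}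
    (hlab : ∀ u ∈ S, ∀ v ∈ S, ∀ w ∉ S, u.1 < R → u.2 < C → v.1 < R → v.2 < C → w.1 < R →
      w.2 < C → lab u = lab v → ((wordGraph α).Adj u w ↔ (wordGraph α).Adj v w))
    (I : Finset ℕ) (hI : ∀ i ∈ I, i < R) (j : ℕ) (hj : j + 1 < C) (P : Prop)
    (h1 : ∀ i ∈ I, ((i, j) ∈ S ↔ P)) (h2 : ∀ i ∈ I, ((i, j + 1) ∈ S ↔ ¬ P)) : I.card ≤ k := by
  by_cases hP : P
  · refine card_le_of_cut hlab I (fun i => ((i, j), (i, j + 1))) ?_ ?_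
    · exact fun i hi => ⟨(h1 i hi).2 hP, fun h => (h2 i hi).1 h hP, hI i hi, by simp only; omega,
        hI i hi, hj⟩
    · intro i hi i' hi' hne
      simp only [wordGraph_adj_succ]
      simp [hne.symm]
  · refine card_le_of_cut hlab I (fun i => ((i, j + 1), (i, j))) ?_ ?_
    · exact fun i hi => ⟨(h2 i hi).2 hP, fun h => hP ((h1 i hi).1 h), hI i hi, hj, hI i hi,
        by simp only; omega⟩
    · intro i hi i' hi' hne
      simp only [(wordGraph α).adj_comm (_, j + 1), wordGraph_adj_succ]
      simp [hne]

/-- A set of at least `r * C` cells in `C` columns meets at least `r` rows. -/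
theorem le_card_image_fst {r : ℕ} (B : Finset (ℕ × ℕ)) (hB : ∀ x ∈ B, x.2 < C) (hC : 0 < C)
    (h : r * C ≤ B.card) : r ≤ (B.image Prod.fst).card := by
  have h1 : B.card ≤ C * (B.image Prod.fst).card := by
    refine Finset.card_le_mul_card_image _ _ fun i _ => ?_
    refine (Finset.card_le_card_of_injOn (t := Finset.range C) Prod.snd ?_ ?_).trans_eq
      (Finset.card_range C)
    · intro x hx
      exact Finset.mem_coe.2 (Finset.mem_range.2
        (hB x (Finset.mem_filter.1 (Finset.mem_coe.1 hx)).1))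
    · intro x hx y hy hxy
      have hx := (Finset.mem_filter.1 (Finset.mem_coe.1 hx)).2
      have hy := (Finset.mem_filter.1 (Finset.mem_coe.1 hy)).2
      exact Prod.ext (hx.trans hy.symm) hxy
  rw [Nat.mul_comm C] at h1
  exact Nat.le_of_mul_le_mul_right (h.trans h1) hC

/-- A large grid has no balanced cut with few neighbourhoods across it: both sides of a cut with at
most `k` labels cannot have a third of the cells each. -/
theorem not_balanced_cut {n : ℕ} {lab : ℕ × ℕ → Fin k}
    (hlab : ∀ u ∈ S, ∀ v ∈ S, ∀ w ∉ S, u.1 < R → u.2 < C → v.1 < R → v.2 < C → w.1 < R →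
      w.2 < C → lab u = lab v →
        ((wordGraph (zerosOneWord n)).Adj u w ↔ (wordGraph (zerosOneWord n)).Adj v w))
    {r : ℕ} (hr : 6 * k * k < r) (hR : R = 3 * r) (hC : C = (n + 1) * (3 * k + 1) + 1)
    (B₁ B₂ : Finset (ℕ × ℕ)) (h₁ : ∀ x ∈ B₁, x.1 < R ∧ x.2 < C ∧ x ∈ S)
    (h₂ : ∀ x ∈ B₂, x.1 < R ∧ x.2 < C ∧ x ∉ S) (hc₁ : r * C ≤ B₁.card) (hc₂ : r * C ≤ B₂.card) :
    False := by
  classical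
  have hR3 : 3 ≤ R := by omega
  have hC0 : 0 < C := by omega
  set A := (Finset.range (C - 1)).filter fun j => IsActiveGap (zerosOneWord n) S R j with hAdef
  have hA : ∀ j, j ∈ A ↔ j + 1 < C ∧ IsActiveGap (zerosOneWord n) S R j := by
    intro j
    rw [hAdef, Finset.mem_filter, Finset.mem_range]
    exact and_congr_left fun _ => by omega
  have hAcard : A.card ≤ 3 * k := card_activeGaps_le hlab A fun j hj => (hA j).1 hj
  -- some gap with the letter `1` is inactive
  obtain ⟨g, hg, hα, hgA⟩ : ∃ g, g + 1 < C ∧ zerosOneWord n g = true ∧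
      ¬ IsActiveGap (zerosOneWord n) S R g := by
    by_contra! hc
    have : (Finset.range (3 * k + 1)).card ≤ A.card := by
      refine Finset.card_le_card_of_injOn (fun t => (n + 1) * t + n) ?_ ?_
      · intro t ht
        have ht := Finset.mem_range.1 (Finset.mem_coe.1 ht)
        have h1 : (n + 1) * (t + 1) ≤ (n + 1) * (3 * k + 1) := Nat.mul_le_mul_left _ ht
        have h2 : (n + 1) * t + n + 1 < C := by rw [mul_add] at h1; omega
        refine Finset.mem_coe.2 ((hA _).2 ⟨h2, hc _ h2 ?_⟩)
        rw [zerosOneWord_eq_true, Nat.mul_add_mod, Nat.mod_eq_of_lt (Nat.lt_succ_self n)]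
      · intro t _ t' _ h
        have h : (n + 1) * t + n = (n + 1) * t' + n := h
        exact Nat.eq_of_mul_eq_mul_left (Nat.succ_pos n) (Nat.add_right_cancel h)
    rw [Finset.card_range] at this
    omega
  -- the colour that column `g` does not have still meets at least `r` rows
  obtain ⟨I, hIr, hIR, hIs⟩ : ∃ I : Finset ℕ, r ≤ I.card ∧ (∀ i ∈ I, i < R) ∧
      ∀ i ∈ I, ∃ j < C, ¬ ((i, j) ∈ S ↔ (i, g) ∈ S) := by
    have hmono : ∀ i < R, ((i, g) ∈ S ↔ (0, g) ∈ S) := fun i hi =>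
      mem_iff_mem_of_not_isActiveGap hR3 hgA hα hi (by omega)
    by_cases h0 : (0, g) ∈ S
    · refine ⟨B₂.image Prod.fst, le_card_image_fst B₂ (fun x hx => (h₂ x hx).2.1) hC0 hc₂, ?_, ?_⟩
      · intro i hi
        obtain ⟨x, hx, rfl⟩ := Finset.mem_image.1 hi
        exact (h₂ x hx).1
      · intro i hi
        obtain ⟨x, hx, rfl⟩ := Finset.mem_image.1 hi
        exact ⟨x.2, (h₂ x hx).2.1, fun h => (h₂ x hx).2.2
          (h.2 ((hmono _ (h₂ x hx).1).2 h0))⟩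
    · refine ⟨B₁.image Prod.fst, le_card_image_fst B₁ (fun x hx => (h₁ x hx).2.1) hC0 hc₁, ?_, ?_⟩
      · intro i hi
        obtain ⟨x, hx, rfl⟩ := Finset.mem_image.1 hi
        exact (h₁ x hx).1
      · intro i hi
        obtain ⟨x, hx, rfl⟩ := Finset.mem_image.1 hi
        exact ⟨x.2, (h₁ x hx).2.1, fun h => h0
          ((hmono _ (h₁ x hx).1).1 (h.1 (h₁ x hx).2.2))⟩
  have hsw : ∀ i, ∃ j, i ∈ I → j + 1 < C ∧ ¬ ((i, j) ∈ S ↔ (i, j + 1) ∈ S) := by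
    intro i
    by_cases hi : i ∈ I
    · obtain ⟨j, hj, hne⟩ := hIs i hi
      obtain ⟨j', h⟩ := exists_switch (P := fun j => (i, j) ∈ S) hj (by omega : g < C) hne
      exact ⟨j', fun _ => h⟩
    · exact ⟨0, fun h => absurd h hi⟩
  choose sw hsw using hsw
  let q : ℕ → ℕ × Prop := fun i => (sw i, (i, sw i) ∈ S)
  have hq : I.card ≤ k * (I.image q).card := by
    refine Finset.card_le_mul_card_image _ _ fun b hb => ?_
    obtain ⟨i₀, hi₀, rfl⟩ := Finset.mem_image.1 hb
    have hfib : ∀ i ∈ I.filter (fun i => q i = q i₀),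
        i ∈ I ∧ sw i = sw i₀ ∧ ((i, sw i) ∈ S ↔ (i₀, sw i₀) ∈ S) := by
      intro i hi
      rw [Finset.mem_filter] at hi
      exact ⟨hi.1, congrArg Prod.fst hi.2, iff_of_eq (congrArg Prod.snd hi.2)⟩
    refine card_switching_rows_le hlab _ (fun i hi => hIR i (hfib i hi).1) (sw i₀)
      (hsw i₀ hi₀).1 ((i₀, sw i₀) ∈ S) ?_ ?_
    · intro i hi
      obtain ⟨-, h1, h2⟩ := hfib i hi
      rwa [h1] at h2
    · intro i hi
      obtain ⟨h0, h1, h2⟩ := hfib i hi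
      have h3 := (hsw i h0).2
      rw [h1] at h2 h3
      tauto
  have hq' : (I.image q).card ≤ 3 * k * 2 := by
    refine (Finset.card_le_card (t := A ×ˢ {True, False}) ?_).trans ?_
    · intro x hx
      obtain ⟨i, hi, rfl⟩ := Finset.mem_image.1 hx
      obtain ⟨h1, h2⟩ := hsw i hi
      refine Finset.mem_product.2 ⟨(hA _).2 ⟨h1, ?_⟩, ?_⟩
      · by_contra hna
        exact h2 (mem_iff_of_not_isActiveGap hR3 hna (hIR i hi))
      · rw [Finset.mem_insert, Finset.mem_singleton]
        exact Classical.propComplete _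
    · rw [Finset.card_product]
      exact Nat.mul_le_mul hAcard Finset.card_le_two
  have : r ≤ k * (3 * k * 2) := hIr.trans (hq.trans (Nat.mul_le_mul_left _ hq'))
  have e : k * (3 * k * 2) = 6 * k * k := by ring
  omega

end Unbounded

/-- The subgraph of the word graph induced by the first `R` rows and `C` columns. -/
def gridGraph (α : ℕ → Bool) (R C : ℕ) : SimpleGraph (Fin (R * C)) :=
  (wordGraph α).comap fun x => ((finProdFinEquiv.symm x).1.1, (finProdFinEquiv.symm x).2.1)

theorem gridGraph_mem_wordClass (α : ℕ → Bool) (R C : ℕ) :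
    (⟨R * C, gridGraph α R C⟩ : FinGraph) ∈ wordClass α := by
  refine ⟨⟨⟨_, ?_⟩, Iff.rfl⟩⟩
  intro x y h
  have h := Prod.mk.inj h
  exact finProdFinEquiv.symm.injective (Prod.ext (Fin.ext h.1) (Fin.ext h.2))

theorem isUnbounded_cliqueWidth_wordClass (n : ℕ) :
    IsUnbounded (fun G => cliqueWidth G.2) (wordClass (zerosOneWord n)) := by
  classical
  intro k
  set r := 6 * k * k + 1 with hr
  set C := (n + 1) * (3 * k + 1) + 1 with hC
  refine ⟨_, gridGraph_mem_wordClass _ (3 * r) C, ?_⟩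
  by_contra hcw
  have hcw : cliqueWidth (gridGraph (zerosOneWord n) (3 * r) C) ≤ k := not_lt.1 hcw
  have hpos : 0 < r * C := Nat.mul_pos (by omega) (by omega)
  have hrC : 3 * r * C = 3 * (r * C) := Nat.mul_assoc _ _ _
  obtain ⟨e, he⟩ : ∃ e : CWExpr (cliqueWidth (gridGraph (zerosOneWord n) (3 * r) C)),
      e.Defines (gridGraph (zerosOneWord n) (3 * r) C) := by
    refine Nat.sInf_mem (s := {k : ℕ | ∃ e : CWExpr k, e.Defines _}) ?_
    obtain ⟨m, hm⟩ : ∃ m, 3 * r * C = m + 1 := ⟨3 * r * C - 1, by omega⟩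
    generalize gridGraph (zerosOneWord n) (3 * r) C = G
    revert G
    rw [hm]
    intro G
    obtain ⟨e, -, he⟩ := CWExpr.exists_linear_defines G
    exact ⟨_, e, he⟩
  obtain ⟨S, hS1, hS2, lab, hlab⟩ := he.exists_balanced_cut (2 * (r * C)) (by omega)
    (by rw [Nat.card_fin]; omega)
  let f : Fin (3 * r * C) → ℕ × ℕ :=
    fun x => ((finProdFinEquiv.symm x).1.1, (finProdFinEquiv.symm x).2.1)
  have hf : Function.Injective f := by
    intro x y h
    have h := Prod.mk.inj h
    exact finProdFinEquiv.symm.injective (Prod.ext (Fin.ext h.1) (Fin.ext h.2))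
  have hf1 : ∀ x, (f x).1 < 3 * r := fun x => (finProdFinEquiv.symm x).1.2
  have hf2 : ∀ x, (f x).2 < C := fun x => (finProdFinEquiv.symm x).2.2
  have hfs : ∀ u : ℕ × ℕ, u.1 < 3 * r → u.2 < C → ∃ x, f x = u := by
    intro u h1 h2
    exact ⟨finProdFinEquiv (⟨u.1, h1⟩, ⟨u.2, h2⟩), by simp only [f, Equiv.symm_apply_apply]⟩
  have hk : 0 < k := by
    have : Nonempty (Fin (3 * r * C)) := ⟨⟨0, by omega⟩⟩
    exact (Fin.pos (lab (Classical.arbitrary _))).trans_le hcw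
  have hcompl : S.ncard + Sᶜ.ncard = 3 * r * C := by
    rw [Set.ncard_add_ncard_compl, Nat.card_fin]
  refine not_balanced_cut (S := f '' S) (n := n) (r := r) (k := k) (R := 3 * r) (C := C)
    (lab := fun u => if h : ∃ x, f x = u then Fin.castLE hcw (lab h.choose) else ⟨0, hk⟩)
    ?_ (Nat.lt_succ_self _) rfl hC (S.toFinset.image f) (Sᶜ.toFinset.image f) ?_ ?_ ?_ ?_
  · rintro _ ⟨u, hu, rfl⟩ _ ⟨v, hv, rfl⟩ w hw - - - - hw1 hw2 huv
    obtain ⟨w, rfl⟩ := hfs w hw1 hw2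
    have hch : ∀ x, (if h : ∃ y, f y = f x then Fin.castLE hcw (lab h.choose) else ⟨0, hk⟩)
        = Fin.castLE hcw (lab x) := by
      intro x
      have h : ∃ y, f y = f x := ⟨x, rfl⟩
      rw [dif_pos h, hf h.choose_spec]
    simp only [hch] at huv
    exact hlab u hu v hv (Fin.castLE_injective hcw huv) w fun h => hw ⟨w, h, rfl⟩
  · intro x hx
    obtain ⟨y, hy, rfl⟩ := Finset.mem_image.1 hx
    exact ⟨hf1 y, hf2 y, y, Set.mem_toFinset.1 hy, rfl⟩
  · intro x hx
    obtain ⟨y, hy, rfl⟩ := Finset.mem_image.1 hx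
    refine ⟨hf1 y, hf2 y, ?_⟩
    rintro ⟨z, hz, hzy⟩
    exact Set.mem_toFinset.1 hy (hf hzy ▸ hz)
  · rw [Finset.card_image_of_injective _ hf, ← Set.ncard_eq_toFinset_card']
    omega
  · rw [Finset.card_image_of_injective _ hf, ← Set.ncard_eq_toFinset_card']
    omega

/-! ### Bounded linear clique-width of proper hereditary subclasses -/

theorem isHereditary_wordClass (α : ℕ → Bool) : IsHereditary (wordClass α) :=
  fun _ ⟨g⟩ _ ⟨h⟩ => ⟨g.comp h⟩

theorem IsUnbounded.linearCliqueWidth {X : Set FinGraph}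
    (h : IsUnbounded (fun G => cliqueWidth G.2) X) :
    IsUnbounded (fun G => linearCliqueWidth G.2) X := by
  intro k
  obtain ⟨G, hG, hk⟩ := h k
  exact ⟨G, hG, lt_of_lt_of_le hk (cliqueWidth_le_linearCliqueWidth G.2)⟩

/-- Row `i` is full in block `b`: all its cells in the columns `b * c, …, b * c + c - 1` are in
`W`. -/
def IsFullRow (W : Set (ℕ × ℕ)) (c b i : ℕ) : Prop :=
  ∀ j, b * c ≤ j → j < b * c + c → (i, j) ∈ W

/-- The stage at which a cell is processed in the ordering that bounds the linear clique-width.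
A row that is not full in a block has a hole `hole b i` there: the cells of the block left of it
get the number of the block, those right of it the number of the next block. So a segment of a row
between two consecutive holes belongs to one stage. -/
noncomputable def stage (W : Set (ℕ × ℕ)) (c : ℕ) (hole : ℕ → ℕ → ℕ) (v : ℕ × ℕ) : ℕ :=
  open Classical in
  if IsFullRow W c (v.2 / c) v.1 ∨ v.2 < hole (v.2 / c) v.1 then v.2 / c else v.2 / c + 1

section Stage

variable {W : Set (ℕ × ℕ)} {c : ℕ} {hole : ℕ → ℕ → ℕ}

theorem stage_bounds (hc : 0 < c) (v : ℕ × ℕ) :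
    stage W c hole v * c ≤ v.2 + c ∧ v.2 < stage W c hole v * c + c := by
  have h1 : v.2 / c * c ≤ v.2 := Nat.div_mul_le_self _ _
  have h2 : v.2 < v.2 / c * c + c := by
    have := Nat.lt_mul_div_succ v.2 hc
    rw [mul_add, mul_one, mul_comm] at this
    exact this
  unfold stage
  split_ifs
  · omega
  · rw [add_mul, one_mul]; omega

/-- Horizontal neighbours in `W` are processed at the same stage unless the row is full in one of
their blocks. -/
theorem stage_eq_of_succ (hc : 0 < c)
    (hhole : ∀ b i, ¬ IsFullRow W c b i →
      b * c ≤ hole b i ∧ hole b i < b * c + c ∧ (i, hole b i) ∉ W)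
    {i j : ℕ} (hu : (i, j) ∈ W) (hv : (i, j + 1) ∈ W) (h1 : ¬ IsFullRow W c (j / c) i)
    (h2 : ¬ IsFullRow W c ((j + 1) / c) i) :
    stage W c hole (i, j) = stage W c hole (i, j + 1) := by
  have e1 : ∀ j : ℕ, j / c * c ≤ j ∧ j < j / c * c + c := by
    intro j
    refine ⟨Nat.div_mul_le_self _ _, ?_⟩
    have := Nat.lt_mul_div_succ j hc
    rw [mul_add, mul_one, mul_comm] at this
    exact this
  have hne1 : hole (j / c) i ≠ j := fun h => (hhole _ _ h1).2.2 (by rw [h]; exact hu)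
  have hne2 : hole ((j + 1) / c) i ≠ j + 1 := fun h => (hhole _ _ h2).2.2 (by rw [h]; exact hv)
  obtain ⟨a1, a2, -⟩ := hhole _ _ h1
  obtain ⟨b1, b2, -⟩ := hhole _ _ h2
  unfold stage
  simp only [h1, h2, false_or]
  by_cases hb : (j + 1) / c = j / c
  · rw [hb] at hne2 ⊢
    split_ifs <;> omega
  · have hb' : (j + 1) / c = j / c + 1 := by
      have h3 : j / c ≤ (j + 1) / c := Nat.div_le_div_right (Nat.le_succ j)
      have h4 : (j + 1) / c ≤ (j + c) / c := Nat.div_le_div_right (by omega)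
      rw [Nat.add_div_right _ hc] at h4
      omega
    have := e1 j
    have h6 := e1 (j + 1)
    rw [hb'] at hne2 b1 b2 h6 ⊢
    rw [add_mul, one_mul] at h6 b1 b2
    rw [if_neg (by omega), if_pos (by omega)]

end Stage

theorem exists_injOn_fin {I : Finset ℕ} {m : ℕ} (h : I.card ≤ m + 1) :
    ∃ g : ℕ → Fin (m + 1), Set.InjOn g I := by
  classical
  obtain ⟨g, hg⟩ := Function.Embedding.nonempty_of_card_le
    (α := I) (β := Fin (m + 1)) (by simpa using h)
  refine ⟨fun i => if h : i ∈ I then g ⟨i, h⟩ else 0, ?_⟩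
  intro i hi j hj hij
  simp only [Finset.mem_coe.1 hi, Finset.mem_coe.1 hj, dite_true] at hij
  exact congrArg Subtype.val (hg hij)

/-- If every block of `c` columns has at most `r` full rows, the linear clique-width is bounded.
The cells are ordered by stage, then row by row. When cell `x` has just been processed, only the
`2 * c + 1` columns around the blocks of its stage matter, and in each of these columns two
processed cells have the same neighbours ahead unless their row is that of `x` or is full in a
nearby block. -/
theorem linearCliqueWidth_le_of_fullRows {N c r : ℕ} (hc : 0 < c) {α : ℕ → Bool}
    {G : SimpleGraph (Fin N)} (φ : G ↪g wordGraph α)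
    (hr : ∀ b, ∀ I : Finset ℕ, (∀ i ∈ I, IsFullRow (Set.range φ) c b i) → I.card ≤ r) :
    linearCliqueWidth G ≤
      Fintype.card (Option (Fin (2 * c + 1) × Option (Fin (4 * r + 1)))) + 1 := by
  classical
  set W := Set.range φ
  have hhole : ∃ hole : ℕ → ℕ → ℕ, ∀ b i, ¬ IsFullRow W c b i →
      b * c ≤ hole b i ∧ hole b i < b * c + c ∧ (i, hole b i) ∉ W := by
    have : ∀ b i, ∃ m, ¬ IsFullRow W c b i → b * c ≤ m ∧ m < b * c + c ∧ (i, m) ∉ W := by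
      intro b i
      by_cases h : IsFullRow W c b i
      · exact ⟨0, fun h' => absurd h h'⟩
      · unfold IsFullRow at h
        push Not at h
        obtain ⟨m, h1, h2, h3⟩ := h
        exact ⟨m, fun _ => ⟨h1, h2, h3⟩⟩
    choose hole h using this
    exact ⟨hole, h⟩
  obtain ⟨hole, hhole⟩ := hhole
  let K : Fin N → ℕ ×ₗ (ℕ ×ₗ ℕ) := fun a => toLex (stage W c hole (φ a), toLex (φ a))
  refine linearCliqueWidth_le_of_ordering G K ?_ ?_
  · intro a b h
    have h1 : (ofLex (K a)).2 = (ofLex (K b)).2 := by rw [h]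
    exact φ.injective (toLex.injective h1)
  intro x
  obtain ⟨s, i₀, j₀, rfl⟩ : ∃ s i j, x = toLex (s, toLex (i, j)) :=
    ⟨(ofLex x).1, (ofLex (ofLex x).2).1, (ofLex (ofLex x).2).2, rfl⟩
  have hle : ∀ a, K a ≤ toLex (s, toLex (i₀, j₀)) ↔ stage W c hole (φ a) < s ∨
      (stage W c hole (φ a) = s ∧ ((φ a).1 < i₀ ∨ ((φ a).1 = i₀ ∧ (φ a).2 ≤ j₀))) := by
    intro a
    rw [Prod.Lex.toLex_le_toLex]
    exact or_congr Iff.rfl (and_congr Iff.rfl Prod.Lex.toLex_le_toLex)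
  -- the rows that are full in one of the blocks `s - 2, …, s + 1`
  have hfin : ∀ b, {i | IsFullRow W c b i}.Finite := by
    intro b
    refine ((Set.finite_range φ).image Prod.fst).subset fun i hi => ?_
    exact ⟨(i, b * c), hi _ le_rfl (by omega), rfl⟩
  let F : ℕ → Finset ℕ := fun b => (hfin b).toFinset
  have hF : ∀ b i, i ∈ F b ↔ IsFullRow W c b i := fun b i => (hfin b).mem_toFinset
  have hFc : ∀ b, (F b).card ≤ r := fun b => hr b _ fun i hi => (hF b i).1 hi
  let I : Finset ℕ := insert i₀ (F (s - 2) ∪ F (s - 1) ∪ F s ∪ F (s + 1))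
  have hI : I.card ≤ 4 * r + 1 := by
    refine (Finset.card_insert_le _ _).trans ?_
    have h1 := Finset.card_union_le (F (s - 2) ∪ F (s - 1) ∪ F s) (F (s + 1))
    have h2 := Finset.card_union_le (F (s - 2) ∪ F (s - 1)) (F s)
    have h3 := Finset.card_union_le (F (s - 2)) (F (s - 1))
    have := hFc (s - 2)
    have := hFc (s - 1)
    have := hFc s
    have := hFc (s + 1)
    omega
  obtain ⟨g, hg⟩ := exists_injOn_fin hI
  -- residues tell apart the `2 * c + 1` columns that are not yet out of reach; truncation in
  -- `s - 2` and `s - 1` only repeats blocks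
  refine ⟨fun a => if (φ a).2 + c + 1 < s * c then none else
    some (Fin.ofNat (2 * c + 1) (φ a).2, if (φ a).1 ∈ I then some (g (φ a).1) else none), ?_⟩
  intro u v w hu hv hw huv
  beta_reduce at huv
  rw [← not_le, hle] at hw
  rw [hle] at hu hv
  rw [← φ.map_adj_iff, ← φ.map_adj_iff (v := v)]
  have bu := stage_bounds (W := W) (hole := hole) hc (φ u)
  have bv := stage_bounds (W := W) (hole := hole) hc (φ v)
  have bw := stage_bounds (W := W) (hole := hole) hc (φ w)
  have hmul : ∀ a b : ℕ, a ≤ b → a * c ≤ b * c := fun a b h => Nat.mul_le_mul_right c h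
  have hus := hmul (stage W c hole (φ u)) s (by omega)
  have hvs := hmul (stage W c hole (φ v)) s (by omega)
  have hws := hmul s (stage W c hole (φ w)) (by omega)
  by_cases hd : (φ u).2 + c + 1 < s * c
  · have hd' : (φ v).2 + c + 1 < s * c := by
      by_contra h
      rw [if_pos hd, if_neg h] at huv
      cases huv
    rw [wordGraph_adj, wordGraph_adj]
    refine iff_of_false ?_ ?_ <;> omega
  · have hd' : ¬ (φ v).2 + c + 1 < s * c := by
      intro h
      rw [if_neg hd, if_pos h] at huv
      cases huv
    rw [if_neg hd, if_neg hd'] at huv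
    have huv := Prod.mk.inj (Option.some.inj huv)
    have hcol : (φ u).2 = (φ v).2 := by
      have h1 : (φ u).2 % (2 * c + 1) = (φ v).2 % (2 * c + 1) := by
        simpa [Fin.ofNat] using congrArg Fin.val huv.1
      rcases le_total (φ u).2 (φ v).2 with h | h
      · have h2 := (Nat.modEq_iff_dvd' h).1 h1
        by_contra hne
        have := Nat.le_of_dvd (by omega) h2
        omega
      · have h2 := (Nat.modEq_iff_dvd' h).1 h1.symm
        by_contra hne
        have := Nat.le_of_dvd (by omega) h2
        omega
    by_cases hi : (φ u).1 ∈ I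
    · have hi' : (φ v).1 ∈ I := by
        by_contra h
        rw [if_pos hi, if_neg h] at huv
        cases huv.2
      rw [if_pos hi, if_pos hi'] at huv
      have : φ u = φ v := Prod.ext (hg hi hi' (Option.some.inj huv.2)) hcol
      rw [this]
    · have hi' : (φ v).1 ∉ I := by
        intro h
        rw [if_neg hi, if_pos h] at huv
        cases huv.2
      -- a regular cell has no horizontal neighbour ahead
      have key : ∀ a, (φ a).1 ∉ I → (stage W c hole (φ a) < s ∨
          (stage W c hole (φ a) = s ∧ ((φ a).1 < i₀ ∨ ((φ a).1 = i₀ ∧ (φ a).2 ≤ j₀)))) →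
          ¬ (φ a).2 + c + 1 < s * c → (φ a).2 < s * c + c →
          ((φ a).2 + 1 = (φ w).2 ∨ (φ w).2 + 1 = (φ a).2) → (φ a).1 ≠ (φ w).1 := by
        intro a ha hla hda hda' hadj heq
        simp only [I, Finset.mem_insert, Finset.mem_union, not_or, hF] at ha
        obtain ⟨ha0, ⟨⟨ha1, ha2⟩, ha3⟩, ha4⟩ := ha
        have hblk : ∀ j : ℕ, s * c ≤ j + c + 1 → j ≤ s * c + c →
            ¬ IsFullRow W c (j / c) (φ a).1 := by
          intro j hj1 hj2
          have h1 : s ≤ j / c + 2 := by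
            rw [← Nat.add_mul_div_right j 2 hc, Nat.le_div_iff_mul_le hc]
            omega
          have h2 : j / c < s + 2 := by
            rw [Nat.div_lt_iff_lt_mul hc, add_mul]
            omega
          generalize j / c = q at h1 h2 ⊢
          have h3 : q = s - 2 ∨ q = s - 1 ∨ q = s ∨ q = s + 1 := by omega
          rcases h3 with h3 | h3 | h3 | h3 <;> rw [h3] <;> assumption
        have hst : stage W c hole (φ a) = stage W c hole (φ w) := by
          have ma : ((φ a).1, (φ a).2) ∈ W := ⟨a, rfl⟩
          have mw : ((φ a).1, (φ w).2) ∈ W := ⟨w, Prod.ext heq.symm rfl⟩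
          have ew : φ w = ((φ a).1, (φ w).2) := Prod.ext heq.symm rfl
          have fa := hblk (φ a).2 (by omega) (by omega)
          have fw := hblk (φ w).2 (by omega) (by omega)
          rw [ew, show φ a = ((φ a).1, (φ a).2) from rfl]
          rcases hadj with h | h
          · rw [← h] at mw fw ⊢
            exact stage_eq_of_succ hc hhole ma mw fa fw
          · rw [← h] at ma fa ⊢
            exact (stage_eq_of_succ hc hhole mw ma fw fa).symm
        rw [← hst, ← heq] at hw
        omega
      rw [wordGraph_adj, wordGraph_adj, ← hcol]
      have ku := key u hi hu hd (by omega)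
      have kv := key v hi' hv hd' (by omega)
      rw [← hcol] at kv
      constructor
      · rintro (⟨h1, h2⟩ | ⟨h1, h2⟩)
        · exact Or.inl ⟨h1, iff_of_true (h2.2 (ku (Or.inl h1))) (kv (Or.inl h1))⟩
        · exact Or.inr ⟨h1, iff_of_true (h2.2 (ku (Or.inr h1))) (kv (Or.inr h1))⟩
      · rintro (⟨h1, h2⟩ | ⟨h1, h2⟩)
        · exact Or.inl ⟨h1, iff_of_true (h2.2 (kv (Or.inl h1))) (ku (Or.inl h1))⟩
        · exact Or.inr ⟨h1, iff_of_true (h2.2 (kv (Or.inr h1))) (ku (Or.inr h1))⟩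

/-- A finite set of cells in `r` rows and `c` columns, with `c` a multiple of the period, is
realized in any `r` full rows of an aligned block. -/
theorem exists_embedding_of_fullRows {n N M c r b : ℕ} {G : SimpleGraph (Fin N)}
    {H : SimpleGraph (Fin M)} (φ : G ↪g wordGraph (zerosOneWord n))
    (ψ : H ↪g wordGraph (zerosOneWord n)) (hdvd : n + 1 ∣ c)
    (hψ : ∀ a, (ψ a).1 < r ∧ (ψ a).2 < c) (I : Finset ℕ)
    (hI : ∀ i ∈ I, IsFullRow (Set.range φ) c b i) (hr : r ≤ I.card) : Nonempty (H ↪g G) := by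
  obtain ⟨ρ⟩ : Nonempty (Fin r ↪ I) :=
    Function.Embedding.nonempty_of_card_le (by simpa using hr)
  have hmem : ∀ a, ∃ x, φ x = ((ρ ⟨(ψ a).1, (hψ a).1⟩ : ℕ), b * c + (ψ a).2) := fun a =>
    hI _ (ρ ⟨(ψ a).1, (hψ a).1⟩).2 _ (Nat.le_add_right _ _) (by have := (hψ a).2; omega)
  choose f hf using hmem
  have hρ : ∀ a a', (ρ ⟨(ψ a).1, (hψ a).1⟩ : ℕ) = ρ ⟨(ψ a').1, (hψ a').1⟩ ↔
      (ψ a).1 = (ψ a').1 := by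
    intro a a'
    rw [← Subtype.ext_iff, ρ.injective.eq_iff, Fin.mk.injEq]
  have hper : ∀ j, (zerosOneWord n (b * c + j) = true ↔ zerosOneWord n j = true) := by
    intro j
    obtain ⟨d, rfl⟩ := hdvd
    rw [zerosOneWord_eq_true, zerosOneWord_eq_true,
      show b * ((n + 1) * d) + j = (n + 1) * (b * d) + j by ring, Nat.mul_add_mod]
  refine ⟨⟨⟨f, ?_⟩, ?_⟩⟩
  · intro a a' h
    have h1 : φ (f a) = φ (f a') := congrArg φ h
    rw [hf, hf] at h1
    have h1 := Prod.mk.inj h1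
    exact ψ.injective (Prod.ext ((hρ a a').1 h1.1) (Nat.add_left_cancel h1.2))
  · intro a a'
    rw [← ψ.map_adj_iff, ← φ.map_adj_iff]
    change (wordGraph _).Adj (φ (f a)) (φ (f a')) ↔ _
    rw [hf, hf, wordGraph_adj, wordGraph_adj]
    simp only [hper, ne_eq, hρ, add_assoc, Nat.add_left_cancel_iff]

theorem not_isUnbounded_linearCliqueWidth_of_ssubset {n : ℕ} {Y : Set FinGraph}
    (hY : IsHereditary Y) (hss : Y ⊂ wordClass (zerosOneWord n)) :
    ¬ IsUnbounded (fun G => linearCliqueWidth G.2) Y := by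
  obtain ⟨hsub, hns⟩ := hss
  rw [Set.not_subset] at hns
  obtain ⟨⟨M, H⟩, ⟨ψ⟩, hHY⟩ := hns
  obtain ⟨r, hr⟩ : ∃ r, ∀ a, (ψ a).1 < r ∧ (ψ a).2 < r := by
    obtain ⟨r, hr⟩ := ((Set.finite_range fun a => (ψ a).1 + (ψ a).2)).bddAbove
    refine ⟨r + 1, fun a => ?_⟩
    have := hr ⟨a, rfl⟩
    simp only at this
    omega
  set c := (n + 1) * (r + 1)
  have hrc : r ≤ c := by
    have : 1 * (r + 1) ≤ c := Nat.mul_le_mul_right _ (by omega)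
    omega
  have hc : 0 < c := Nat.mul_pos (by omega) (by omega)
  intro hub
  obtain ⟨⟨N, G⟩, hG, hlt⟩ :=
    hub (Fintype.card (Option (Fin (2 * c + 1) × Option (Fin (4 * r + 1)))) + 1)
  obtain ⟨φ⟩ := hsub hG
  refine absurd (linearCliqueWidth_le_of_fullRows (r := r) hc φ fun b I hI => ?_) (not_le.2 hlt)
  by_contra hcard
  exact hHY (hY _ hG _ (exists_embedding_of_fullRows φ ψ (Dvd.intro _ rfl)
    (fun a => ⟨(hr a).1, (hr a).2.trans_le hrc⟩) I hI (not_le.1 hcard).le))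

theorem isMinimalUnboundedCliqueWidth_wordClass (n : ℕ) :
    IsMinimalUnboundedCliqueWidth (wordClass (zerosOneWord n)) :=
  ⟨isHereditary_wordClass _, isUnbounded_cliqueWidth_wordClass n, fun _ hY hss hub =>
    not_isUnbounded_linearCliqueWidth_of_ssubset hY hss hub.linearCliqueWidth⟩

theorem isMinimalUnboundedLinearCliqueWidth_wordClass (n : ℕ) :
    IsMinimalUnboundedLinearCliqueWidth (wordClass (zerosOneWord n)) :=
  ⟨isHereditary_wordClass _, (isUnbounded_cliqueWidth_wordClass n).linearCliqueWidth,
    fun _ hY hss => not_isUnbounded_linearCliqueWidth_of_ssubset hY hss⟩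

/-! ### Induced cycles -/

theorem cycleGraph_adj_iff_val {N : ℕ} (hN : 2 < N) (u v : Fin N) :
    (SimpleGraph.cycleGraph N).Adj u v ↔ u.1 + 1 = v.1 ∨ v.1 + 1 = u.1 ∨
      (u.1 = 0 ∧ v.1 + 1 = N) ∨ (v.1 = 0 ∧ u.1 + 1 = N) := by
  have key : ∀ a b : Fin N, (a - b).val = 1 ↔ b.1 + 1 = a.1 ∨ (a.1 = 0 ∧ b.1 + 1 = N) := by
    intro a b
    have ha := a.2
    have hb := b.2
    rw [Fin.val_sub]
    by_cases h : b.1 ≤ a.1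
    · rw [show N - b.1 + a.1 = a.1 - b.1 + N by omega, Nat.add_mod_right,
        Nat.mod_eq_of_lt (by omega)]
      omega
    · rw [Nat.mod_eq_of_lt (by omega)]
      omega
  rw [SimpleGraph.cycleGraph_adj', key, key]
  tauto

/-- Two rows through the `n + 1` columns between two consecutive letters `1`, closed up by one
vertex of a third row on either side. -/
theorem cycleGraph_mem_wordClass (n : ℕ) :
    (⟨2 * (n + 2), SimpleGraph.cycleGraph (2 * (n + 2))⟩ : FinGraph) ∈
      wordClass (zerosOneWord n) := by
  have hα : ∀ c, n ≤ c → c ≤ 2 * n + 1 →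
      (zerosOneWord n c = true ↔ c = n ∨ c = 2 * n + 1) := by
    intro c h1 h2
    rw [zerosOneWord_eq_true]
    rcases h1.eq_or_lt with rfl | h1
    · rw [Nat.mod_eq_of_lt (Nat.lt_succ_self _)]
      simp
    · rw [Nat.mod_eq_sub_mod h1, Nat.mod_eq_of_lt (by omega)]
      omega
  let row : ℕ → ℕ := fun p => if p = 0 ∨ p = n + 2 then 2 else if p < n + 2 then 0 else 1
  let col : ℕ → ℕ := fun p => if p ≤ n + 2 then n + p else 3 * n + 4 - p
  have hcol : ∀ p, p < 2 * (n + 2) → n ≤ col p ∧ col p ≤ 2 * n + 2 := by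
    intro p hp
    simp only [col]
    split_ifs <;> omega
  have hadj : ∀ p q, p < 2 * (n + 2) → q < 2 * (n + 2) → col p + 1 = col q →
      ((zerosOneWord n (col p) = true ↔ row p ≠ row q) ↔ p + 1 = q ∨ q + 1 = p ∨
        (p = 0 ∧ q + 1 = 2 * (n + 2)) ∨ (q = 0 ∧ p + 1 = 2 * (n + 2))) := by
    intro p q hp hq h
    have h1 := hcol p hp
    have h2 := hcol q hq
    rw [hα _ h1.1 (by omega)]
    simp only [row, col] at h ⊢
    split_ifs at h ⊢ <;> omega
  have hinj : ∀ p q, p < 2 * (n + 2) → q < 2 * (n + 2) → row p = row q → col p = col q →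
      p = q := by
    intro p q hp hq h1 h2
    simp only [row, col] at h1 h2
    split_ifs at h1 h2 <;> omega
  have hfar : ∀ p q, p < 2 * (n + 2) → q < 2 * (n + 2) → (p + 1 = q ∨ q + 1 = p ∨
        (p = 0 ∧ q + 1 = 2 * (n + 2)) ∨ (q = 0 ∧ p + 1 = 2 * (n + 2))) →
      col p + 1 = col q ∨ col q + 1 = col p := by
    intro p q hp hq h
    simp only [col]
    split_ifs <;> omega
  have hiff : ∀ p q : Fin (2 * (n + 2)), (wordGraph (zerosOneWord n)).Adj (row p, col p)
      (row q, col q) ↔ (SimpleGraph.cycleGraph (2 * (n + 2))).Adj p q := by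
    intro p q
    have h1 : col p + 1 = col q → ((zerosOneWord n (col p) = true ↔ row p ≠ row q) ↔
        (SimpleGraph.cycleGraph (2 * (n + 2))).Adj p q) := by
      rw [cycleGraph_adj_iff_val (by omega)]
      exact hadj p q p.2 q.2
    have h2 : col q + 1 = col p → ((zerosOneWord n (col q) = true ↔ row q ≠ row p) ↔
        (SimpleGraph.cycleGraph (2 * (n + 2))).Adj p q) := by
      rw [SimpleGraph.adj_comm, cycleGraph_adj_iff_val (by omega)]
      exact hadj q p q.2 p.2
    have h3 : (SimpleGraph.cycleGraph (2 * (n + 2))).Adj p q →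
        col p + 1 = col q ∨ col q + 1 = col p := by
      rw [cycleGraph_adj_iff_val (by omega)]
      exact hfar p q p.2 q.2
    rw [wordGraph_adj]
    rw [ne_comm (a := row q)] at h2
    constructor
    · rintro (⟨h4, h5⟩ | ⟨h4, h5⟩)
      · exact (h1 h4).1 h5
      · exact (h2 h4).1 h5
    · intro h
      rcases h3 h with h4 | h4
      · exact Or.inl ⟨h4, (h1 h4).2 h⟩
      · exact Or.inr ⟨h4, (h2 h4).2 h⟩
  refine ⟨⟨⟨fun p => (row p, col p), ?_⟩, hiff _ _⟩⟩
  intro p q h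
  have h := Prod.mk.inj h
  exact Fin.ext (hinj p q p.2 q.2 h.1 h.2)

theorem add_mod_eq_ite_of_lt {N t d : ℕ} (hd : d < N) :
    (t + d) % N = if t % N + d < N then t % N + d else t % N + d - N := by
  have ht : t % N < N := Nat.mod_lt _ (by omega)
  rw [Nat.add_mod, Nat.mod_eq_of_lt hd]
  split_ifs with h
  · exact Nat.mod_eq_of_lt h
  · rw [Nat.mod_eq_sub_mod (not_lt.1 h), Nat.mod_eq_of_lt (by omega)]

/-- An induced cycle of length at least eight turns back, on the left and on the right, at letters
`1`. If these two letters are the same occurrence the whole cycle lies in two columns, and a vertex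
has two non-neighbours in the other column; otherwise they are `m + 1` columns apart and
the cycle, crossing between them twice, is too long. -/
theorem cycleGraph_notMem_wordClass {m N : ℕ} (hN : 8 ≤ N) (hm : N ≤ 2 * (m + 1)) :
    (⟨N, SimpleGraph.cycleGraph N⟩ : FinGraph) ∉ wordClass (zerosOneWord m) := by
  rintro ⟨φ⟩
  have hN0 : 0 < N := by omega
  let f : ℕ → ℕ × ℕ := fun t => φ ⟨t % N, Nat.mod_lt _ hN0⟩
  have hf : ∀ a : Fin N, φ a = f a := by
    intro a
    simp only [f, Nat.mod_eq_of_lt a.2]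
  have hper : ∀ t, f (t + N) = f t := by
    intro t
    simp only [f, Nat.add_mod_right]
  have hadj : ∀ t d, 0 < d → d < N →
      ((wordGraph (zerosOneWord m)).Adj (f t) (f (t + d)) ↔ d = 1 ∨ d + 1 = N) := by
    intro t d h0 hd
    have ht : t % N < N := Nat.mod_lt _ hN0
    change (wordGraph (zerosOneWord m)).Adj (φ _) (φ _) ↔ _
    rw [φ.map_adj_iff, cycleGraph_adj_iff_val (by omega)]
    simp only [add_mod_eq_ite_of_lt hd]
    split_ifs <;> omega
  have hinj : ∀ t d, 0 < d → d < N → f t ≠ f (t + d) := by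
    intro t d h0 hd h
    have ht : t % N < N := Nat.mod_lt _ hN0
    have h1 := congrArg Fin.val (φ.injective h)
    simp only [add_mod_eq_ite_of_lt hd] at h1
    split_ifs at h1 <;> omega
  have hstep : ∀ t, (wordGraph (zerosOneWord m)).Adj (f t) (f (t + 1)) := fun t =>
    (hadj t 1 (by omega) (by omega)).2 (Or.inl rfl)
  have hcol : ∀ u v, (wordGraph (zerosOneWord m)).Adj u v → u.2 + 1 = v.2 ∨ v.2 + 1 = u.2 := by
    intro u v h
    rw [wordGraph_adj] at h
    omega
  have hup : ∀ t d, (f (t + d)).2 ≤ (f t).2 + d ∧ (f t).2 ≤ (f (t + d)).2 + d := by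
    intro t d
    induction d with
    | zero => exact ⟨le_rfl, le_rfl⟩
    | succ d ih =>
      have := hcol _ _ (hstep (t + d))
      rw [add_assoc] at this
      omega
  have hne : (Finset.univ : Finset (Fin N)).Nonempty := ⟨⟨0, hN0⟩, Finset.mem_univ _⟩
  obtain ⟨a, -, ha⟩ := Finset.exists_min_image Finset.univ (fun x : Fin N => (f x).2) hne
  obtain ⟨b, -, hb⟩ := Finset.exists_max_image Finset.univ (fun x : Fin N => (f x).2) hne
  have hmin : ∀ t, (f a).2 ≤ (f t).2 := by
    intro t
    have := ha ⟨t % N, Nat.mod_lt _ hN0⟩ (Finset.mem_univ _)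
    simpa only [f, Nat.mod_mod] using this
  have hmax : ∀ t, (f t).2 ≤ (f b).2 := by
    intro t
    have := hb ⟨t % N, Nat.mod_lt _ hN0⟩ (Finset.mem_univ _)
    simpa only [f, Nat.mod_mod] using this
  -- both neighbours of an extremal vertex lie in the same column
  have hnb : ∀ t, (wordGraph (zerosOneWord m)).Adj (f t) (f (t + 1)) ∧
      (wordGraph (zerosOneWord m)).Adj (f t) (f (t + (N - 1))) ∧ f (t + 1) ≠ f (t + (N - 1)) := by
    intro t
    refine ⟨hstep t, (hadj t (N - 1) (by omega) (by omega)).2 (Or.inr (by omega)), ?_⟩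
    have := hinj (t + 1) (N - 2) (by omega) (by omega)
    rwa [show t + 1 + (N - 2) = t + (N - 1) by omega] at this
  have hI : zerosOneWord m (f a).2 = true := by
    obtain ⟨h1, h2, h3⟩ := hnb a
    have h4 := hmin (a + 1)
    have h5 := hmin (a + (N - 1))
    by_contra h6
    rw [wordGraph_adj] at h1 h2
    rcases h1 with ⟨h1, h1'⟩ | ⟨h1, h1'⟩ <;> rcases h2 with ⟨h2, h2'⟩ | ⟨h2, h2'⟩ <;>
      first | omega | skip
    simp only [h6] at h1' h2'
    simp only [ne_eq, false_iff, not_not] at h1' h2'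
    exact h3 (Prod.ext (h1'.symm.trans h2') (h1.symm.trans h2))
  have hJ : ∃ J, J + 1 = (f b).2 ∧ zerosOneWord m J = true := by
    obtain ⟨h1, h2, h3⟩ := hnb b
    have h4 := hmax (b + 1)
    have h5 := hmax (b + (N - 1))
    rw [wordGraph_adj] at h1 h2
    rcases h1 with ⟨h1, h1'⟩ | ⟨h1, h1'⟩ <;> rcases h2 with ⟨h2, h2'⟩ | ⟨h2, h2'⟩ <;>
      first | omega | skip
    refine ⟨_, h1, ?_⟩
    have h7 : (f (b + 1)).2 = (f (b + (N - 1))).2 := by omega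
    by_contra h6
    rw [← h7] at h2'
    simp only [h6] at h1' h2'
    simp only [ne_eq, false_iff, not_not] at h1' h2'
    exact h3 (Prod.ext (h1'.symm.trans h2') h7)
  obtain ⟨J, hJb, hJ⟩ := hJ
  have hIJ : (f a).2 ≤ J := by
    have h1 := hmin (a + 1)
    have h2 := hmax (a + 1)
    have h3 := hcol _ _ (hstep a)
    clear * - h1 h2 h3 hJb
    omega
  by_cases hd : J = (f a).2
  · -- the cycle alternates between two columns
    have halt : ∀ t, (f t).2 = (f a).2 ∨ (f t).2 = (f a).2 + 1 := by
      intro t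
      have h1 := hmin t
      have h2 := hmax t
      clear * - h1 h2 hd hJb
      omega
    have hright : ∀ t, (f t).2 = (f a).2 → (f (t + 1)).2 = (f a).2 + 1 := by
      intro t ht
      have h1 := hcol _ _ (hstep t)
      have h2 := halt (t + 1)
      clear * - h1 h2 ht
      omega
    have hleft : ∀ t, (f t).2 = (f a).2 + 1 → (f (t + 1)).2 = (f a).2 := by
      intro t ht
      have h1 := hcol _ _ (hstep t)
      have h2 := halt (t + 1)
      clear * - h1 h2 ht
      omega
    have c3 := hright _ (hleft _ (hright _ rfl))
    have c5 := hright _ (hleft _ c3)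
    have n3 := mt (hadj a 3 (by omega) (by omega)).1 (by omega)
    have n5 := mt (hadj a 5 (by omega) (by omega)).1 (by omega)
    rw [wordGraph_adj] at n3 n5
    simp only [hI] at n3 n5
    refine hinj (a + 3) 2 (by omega) (by omega) (Prod.ext ?_ ?_)
    · have e3 : (f a).1 = (f (a + 3)).1 := by
        by_contra h
        exact n3 (Or.inl ⟨c3.symm, by simp [h]⟩)
      have e5 : (f a).1 = (f (a + 5)).1 := by
        by_contra h
        exact n5 (Or.inl ⟨c5.symm, by simp [h]⟩)
      exact e3.symm.trans e5
    · exact c3.trans c5.symm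
  · have hdist : m + 1 ≤ J - (f a).2 := by
      rw [zerosOneWord_eq_true] at hI hJ
      exact Nat.le_of_dvd (by omega) ((Nat.modEq_iff_dvd' hIJ).1 (hI.trans hJ.symm))
    have ha' := a.2
    have hb' := b.2
    rcases le_total a.1 b.1 with h | h
    · have h1 := (hup a (b - a)).1
      have h2 := (hup b (N - (b - a))).2
      rw [show a.1 + (b.1 - a.1) = b.1 by omega] at h1
      rw [show b.1 + (N - (b.1 - a.1)) = a.1 + N by omega, hper] at h2
      omega
    · have h1 := (hup a (N - (a - b))).1
      have h2 := (hup b (a - b)).2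
      rw [show b.1 + (a.1 - b.1) = a.1 by omega] at h2
      rw [show a.1 + (N - (a.1 - b.1)) = b.1 + N by omega, hper] at h1
      omega

/-! ### Distinguishing the classes -/

/-- The columns `x` and `y` are consecutive and separated by a letter `1`. -/
def IsOneGap (α : ℕ → Bool) (x y : ℕ) : Prop :=
  (x + 1 = y ∧ α x = true) ∨ (y + 1 = x ∧ α y = true)

namespace IsOneGap

variable {α : ℕ → Bool} {x y y' : ℕ} {u w : ℕ × ℕ}

theorem symm (h : IsOneGap α x y) : IsOneGap α y x := Or.symm h

theorem right_unique (hα : ∀ j, α j = true → α (j + 1) ≠ true) (h : IsOneGap α x y)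
    (h' : IsOneGap α x y') : y = y' := by
  rcases h with ⟨h1, h2⟩ | ⟨h1, h2⟩ <;> rcases h' with ⟨h3, h4⟩ | ⟨h3, h4⟩
  · omega
  · exact absurd (h3 ▸ h2) (hα _ h4)
  · exact absurd (h1 ▸ h4) (hα _ h2)
  · omega

theorem fst_eq_of_not_adj (h : IsOneGap α u.2 w.2) (hn : ¬ (wordGraph α).Adj u w) :
    u.1 = w.1 := by
  by_contra hne
  refine hn (wordGraph_adj.2 ?_)
  rcases h with ⟨h1, h2⟩ | ⟨h1, h2⟩
  · exact Or.inl ⟨h1, iff_of_true h2 hne⟩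
  · exact Or.inr ⟨h1, iff_of_true h2 hne⟩

end IsOneGap

/-- In a word without two consecutive letters `1`, at most one of three neighbours of a vertex lies
outside the column across the letter `1` next to that vertex. -/
theorem exists_oneGap_of_adj {α : ℕ → Bool} (hα : ∀ j, α j = true → α (j + 1) ≠ true)
    {u w₁ w₂ w₃ : ℕ × ℕ} (h₁ : (wordGraph α).Adj u w₁) (h₂ : (wordGraph α).Adj u w₂)
    (h₃ : (wordGraph α).Adj u w₃) (h₁₂ : w₁ ≠ w₂) (h₁₃ : w₁ ≠ w₃) (h₂₃ : w₂ ≠ w₃) :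
    ∃ y, IsOneGap α u.2 y ∧
      ((w₁.2 = y ∧ w₂.2 = y) ∨ (w₁.2 = y ∧ w₃.2 = y) ∨ (w₂.2 = y ∧ w₃.2 = y)) := by
  have key : ∀ w, (wordGraph α).Adj u w → IsOneGap α u.2 w.2 ∨
      (u.1 = w.1 ∧ ((u.2 + 1 = w.2 ∧ α u.2 ≠ true) ∨ (w.2 + 1 = u.2 ∧ α w.2 ≠ true))) := by
    intro w hw
    rcases wordGraph_adj.1 hw with ⟨h, h'⟩ | ⟨h, h'⟩
    · by_cases hu : α u.2 = true
      · exact Or.inl (Or.inl ⟨h, hu⟩)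
      · exact Or.inr ⟨not_not.1 fun hne => hu (h'.2 hne), Or.inl ⟨h, hu⟩⟩
    · by_cases hu : α w.2 = true
      · exact Or.inl (Or.inr ⟨h, hu⟩)
      · exact Or.inr ⟨not_not.1 fun hne => hu (h'.2 hne), Or.inr ⟨h, hu⟩⟩
  -- at most one neighbour is not across a letter `1`, once there is such a letter
  have one : ∀ y, IsOneGap α u.2 y → ∀ w w', (wordGraph α).Adj u w → (wordGraph α).Adj u w' →
      w ≠ w' → w.2 = y ∨ w'.2 = y := by
    intro y hy w w' hw hw' hne
    rcases key w hw with h | ⟨h, h'⟩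
    · exact Or.inl (h.right_unique hα hy)
    rcases key w' hw' with k | ⟨k, k'⟩
    · exact Or.inr (k.right_unique hα hy)
    exfalso
    have hcol : w.2 ≠ w'.2 := fun hc => hne (Prod.ext (h.symm.trans k) hc)
    rcases hy with ⟨y1, y2⟩ | ⟨y1, y2⟩ <;> rcases h' with ⟨a1, a2⟩ | ⟨a1, a2⟩ <;>
      rcases k' with ⟨b1, b2⟩ | ⟨b1, b2⟩
    · exact a2 y2
    · exact a2 y2
    · exact b2 y2
    · omega
    · omega
    · exact b2 ((by omega : y = w'.2) ▸ y2)
    · exact a2 ((by omega : y = w.2) ▸ y2)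
    · omega
  have ex : ∃ y, IsOneGap α u.2 y := by
    rcases key _ h₁ with h | ⟨h, h'⟩
    · exact ⟨_, h⟩
    rcases key _ h₂ with k | ⟨k, k'⟩
    · exact ⟨_, k⟩
    rcases key _ h₃ with l | ⟨l, l'⟩
    · exact ⟨_, l⟩
    exfalso
    have c₁₂ : w₁.2 ≠ w₂.2 := fun hc => h₁₂ (Prod.ext (h.symm.trans k) hc)
    have c₁₃ : w₁.2 ≠ w₃.2 := fun hc => h₁₃ (Prod.ext (h.symm.trans l) hc)
    have c₂₃ : w₂.2 ≠ w₃.2 := fun hc => h₂₃ (Prod.ext (k.symm.trans l) hc)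
    omega
  obtain ⟨y, hy⟩ := ex
  refine ⟨y, hy, ?_⟩
  have o₁₂ := one y hy _ _ h₁ h₂ h₁₂
  have o₁₃ := one y hy _ _ h₁ h₃ h₁₃
  have o₂₃ := one y hy _ _ h₂ h₃ h₂₃
  tauto

/-- In a word without two consecutive letters `1`, one side of the bipartite complement of a perfect
matching lies in a single column: any two of its vertices have three common neighbours. -/
theorem snd_eq_of_coMatching {α : ℕ → Bool} (hα : ∀ j, α j = true → α (j + 1) ≠ true)
    {a b : Fin 5 → ℕ × ℕ} (hb : Function.Injective b)
    (hab : ∀ i j, (wordGraph α).Adj (a i) (b j) ↔ i ≠ j) (i i' : Fin 5) :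
    (a i).2 = (a i').2 := by
  obtain ⟨j₁, j₂, j₃, h₁₂, h₁₃, h₂₃, h₁, h₂, h₃, h₁', h₂', h₃'⟩ : ∃ j₁ j₂ j₃ : Fin 5, j₁ ≠ j₂ ∧
      j₁ ≠ j₃ ∧ j₂ ≠ j₃ ∧ i ≠ j₁ ∧ i ≠ j₂ ∧ i ≠ j₃ ∧ i' ≠ j₁ ∧ i' ≠ j₂ ∧ i' ≠ j₃ := by
    revert i i'
    decide
  obtain ⟨y, hy, h⟩ := exists_oneGap_of_adj hα ((hab i j₁).2 h₁) ((hab i j₂).2 h₂)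
    ((hab i j₃).2 h₃) (hb.ne h₁₂) (hb.ne h₁₃) (hb.ne h₂₃)
  obtain ⟨y', hy', h'⟩ := exists_oneGap_of_adj hα ((hab i' j₁).2 h₁') ((hab i' j₂).2 h₂')
    ((hab i' j₃).2 h₃') (hb.ne h₁₂) (hb.ne h₁₃) (hb.ne h₂₃)
  have hyy : y = y' := by omega
  rw [← hyy] at hy'
  exact hy.symm.right_unique hα hy'.symm

/-- The bipartite complement of a matching of size five sits in two columns separated by a
letter `1`. -/
theorem isOneGap_of_coMatching {α : ℕ → Bool} (hα : ∀ j, α j = true → α (j + 1) ≠ true)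
    {a b : Fin 5 → ℕ × ℕ} (ha : Function.Injective a) (hb : Function.Injective b)
    (hab : ∀ i j, (wordGraph α).Adj (a i) (b j) ↔ i ≠ j) (i j : Fin 5) :
    IsOneGap α (a i).2 (b j).2 := by
  have h1 := snd_eq_of_coMatching hα hb hab
  have h2 := snd_eq_of_coMatching hα ha (a := b) (b := a)
    fun i j => by rw [SimpleGraph.adj_comm, hab, ne_comm]
  obtain ⟨y, hy, h⟩ := exists_oneGap_of_adj hα ((hab 0 1).2 (by decide))
    ((hab 0 2).2 (by decide)) ((hab 0 3).2 (by decide)) (hb.ne (by decide)) (hb.ne (by decide))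
    (hb.ne (by decide))
  have hyj : y = (b j).2 := by
    rcases h with h | h | h <;> rw [← h.1] <;> exact h2 _ _
  rw [h1 i 0, ← hyj]
  exact hy

/-- Vertices `p i j` inducing a grid with the letters of `β` in `𝒫^α`. -/
theorem exists_grid_of_mem_wordClass {α β : ℕ → Bool} {R C : ℕ}
    (h : (⟨R * C, gridGraph β R C⟩ : FinGraph) ∈ wordClass α) :
    ∃ p : Fin R → Fin C → ℕ × ℕ, (∀ i j i' j', p i j = p i' j' → i = i' ∧ j = j') ∧
      ∀ i j i' j', (wordGraph α).Adj (p i j) (p i' j') ↔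
        (wordGraph β).Adj (i.1, j.1) (i'.1, j'.1) := by
  obtain ⟨φ⟩ := h
  refine ⟨fun i j => φ (finProdFinEquiv (i, j)), ?_, ?_⟩
  · intro i j i' j' h
    exact Prod.mk.inj (finProdFinEquiv.injective (φ.injective h))
  · intro i j i' j'
    rw [φ.map_adj_iff]
    simp only [gridGraph, SimpleGraph.comap_adj, Equiv.symm_apply_apply]

theorem zerosOneWord_succ_ne_true {m j : ℕ} (hm : 1 ≤ m) (h : zerosOneWord m j = true) :
    zerosOneWord m (j + 1) ≠ true := by
  rw [zerosOneWord_eq_true] at h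
  rw [ne_eq, zerosOneWord_eq_true, Nat.add_mod, h, Nat.mod_eq_of_lt (a := 1) (by omega),
    Nat.mod_self]
  omega

theorem zerosOneWord_add_two_ne_true {m j : ℕ} (hm : 2 ≤ m) (h : zerosOneWord m j = true) :
    zerosOneWord m (j + 2) ≠ true := by
  rw [zerosOneWord_eq_true] at h
  rw [ne_eq, zerosOneWord_eq_true, Nat.add_mod, h, Nat.mod_eq_of_lt (a := 2) (by omega),
    Nat.mod_eq_sub_mod (by omega), Nat.mod_eq_of_lt (by omega)]
  omega

/-- Three columns with the letters `11` do not embed once no two letters `1` are consecutive: both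
outer columns would have to sit in the same column. -/
theorem gridGraph_zero_notMem_wordClass {m : ℕ} (hm : 1 ≤ m) :
    (⟨5 * 3, gridGraph (zerosOneWord 0) 5 3⟩ : FinGraph) ∉ wordClass (zerosOneWord m) := by
  intro h
  obtain ⟨p, hinj, hadj⟩ := exists_grid_of_mem_wordClass h
  have hp : ∀ j, Function.Injective fun i => p i j := fun j i i' h => (hinj _ _ _ _ h).1
  have hα : ∀ j, zerosOneWord m j = true → zerosOneWord m (j + 1) ≠ true :=
    fun j => zerosOneWord_succ_ne_true hm
  have h01 : ∀ i j, (wordGraph (zerosOneWord m)).Adj (p i 0) (p j 1) ↔ i ≠ j := by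
    intro i j
    rw [hadj]
    exact wordGraph_adj_succ.trans (by simp [zerosOneWord, Fin.ext_iff])
  have h21 : ∀ i j, (wordGraph (zerosOneWord m)).Adj (p i 2) (p j 1) ↔ i ≠ j := by
    intro i j
    rw [hadj, SimpleGraph.adj_comm]
    exact wordGraph_adj_succ.trans (by simp [zerosOneWord, Fin.ext_iff, eq_comm])
  have g0 := isOneGap_of_coMatching hα (hp 0) (hp 1) h01 0 0
  have g2 := isOneGap_of_coMatching hα (hp 2) (hp 1) h21 0 0
  have e0 := g0.fst_eq_of_not_adj (by simp [h01])
  have e2 := g2.fst_eq_of_not_adj (by simp [h21])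
  have hc := g0.symm.right_unique hα g2.symm
  exact absurd (hinj _ _ _ _ (Prod.ext (e0.trans e2.symm) hc)).2 (by decide)

/-- Columns with the letters `101` do not embed once any two letters `1` are at distance at least
three: both pairs of columns would have to sit at the same letter `1`. -/
theorem gridGraph_one_notMem_wordClass {m : ℕ} (hm : 2 ≤ m) :
    (⟨5 * 5, gridGraph (zerosOneWord 1) 5 5⟩ : FinGraph) ∉ wordClass (zerosOneWord m) := by
  intro h
  obtain ⟨p, hinj, hadj⟩ := exists_grid_of_mem_wordClass h
  have hp : ∀ j, Function.Injective fun i => p i j := fun j i i' h => (hinj _ _ _ _ h).1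
  have hα : ∀ j, zerosOneWord m j = true → zerosOneWord m (j + 1) ≠ true :=
    fun j => zerosOneWord_succ_ne_true (by omega)
  have hα2 : ∀ j, zerosOneWord m j = true → zerosOneWord m (j + 2) ≠ true :=
    fun j => zerosOneWord_add_two_ne_true hm
  have h12 : ∀ i j, (wordGraph (zerosOneWord m)).Adj (p i 1) (p j 2) ↔ i ≠ j := by
    intro i j
    rw [hadj]
    exact wordGraph_adj_succ.trans (by simp [zerosOneWord, Fin.ext_iff])
  have h23 : ∀ i j, (wordGraph (zerosOneWord m)).Adj (p i 2) (p j 3) ↔ i = j := by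
    intro i j
    rw [hadj]
    exact wordGraph_adj_succ.trans (by simp [zerosOneWord, Fin.ext_iff])
  have h34 : ∀ i j, (wordGraph (zerosOneWord m)).Adj (p i 3) (p j 4) ↔ i ≠ j := by
    intro i j
    rw [hadj]
    exact wordGraph_adj_succ.trans (by simp [zerosOneWord, Fin.ext_iff])
  have g12 := isOneGap_of_coMatching hα (hp 1) (hp 2) h12 0 0
  have g34 := isOneGap_of_coMatching hα (hp 3) (hp 4) h34
  have c3 := snd_eq_of_coMatching hα (hp 4) h34
  have hadj23 := wordGraph_adj.1 ((h23 0 0).2 rfl)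
  -- the columns `1` and `3` of the grid share a column, as two distinct letters `1` cannot be
  -- bridged by the letter `0` between the columns `2` and `3`
  have h13 : (p 0 1).2 = (p 0 3).2 := by
    have g := g34 0 0
    rcases g12 with ⟨a1, a2⟩ | ⟨a1, a2⟩ <;> rcases hadj23 with ⟨b1, -⟩ | ⟨b1, -⟩
    · rcases g with ⟨d1, d2⟩ | ⟨d1, d2⟩
      · exact absurd ((by omega : (p 0 3).2 = (p 0 1).2 + 2) ▸ d2) (hα2 _ a2)
      · exact absurd ((by omega : (p 0 4).2 = (p 0 1).2 + 1) ▸ d2) (hα _ a2)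
    · omega
    · omega
    · rcases g with ⟨d1, d2⟩ | ⟨d1, d2⟩
      · exact absurd ((by omega : (p 0 2).2 = (p 0 3).2 + 1) ▸ a2) (hα _ d2)
      · exact absurd ((by omega : (p 0 2).2 = (p 0 4).2 + 2) ▸ a2) (hα2 _ d2)
  have g23 : ∀ j, IsOneGap (zerosOneWord m) (p 0 2).2 (p j 3).2 := by
    intro j
    rw [c3 j 0, ← h13]
    exact g12.symm
  have e1 := (g23 1).fst_eq_of_not_adj (by simp [h23])
  have e2 := (g23 2).fst_eq_of_not_adj (by simp [h23])
  have := hp 3 (Prod.ext (e1.symm.trans e2) (c3 1 2) : p 1 3 = p 2 3)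
  exact absurd this (by decide)

theorem wordClass_zerosOneWord_ne_of_lt {n m : ℕ} (h : n < m) :
    wordClass (zerosOneWord n) ≠ wordClass (zerosOneWord m) := by
  intro heq
  rcases n with _ | _ | n
  · exact gridGraph_zero_notMem_wordClass h (heq ▸ gridGraph_mem_wordClass _ 5 3)
  · exact gridGraph_one_notMem_wordClass h (heq ▸ gridGraph_mem_wordClass _ 5 5)
  · exact cycleGraph_notMem_wordClass (by omega) (by omega)
      (heq ▸ cycleGraph_mem_wordClass (n + 2))

theorem wordClass_zerosOneWord_injective :
    Function.Injective fun n => wordClass (zerosOneWord n) := by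
  intro n m h
  rcases lt_trichotomy n m with hlt | rfl | hlt
  · exact absurd h (wordClass_zerosOneWord_ne_of_lt hlt)
  · rfl
  · exact absurd h.symm (wordClass_zerosOneWord_ne_of_lt hlt)

theorem theorem2 :
    -- there are infinitely many minimal classes, for both parameters
    {X : Set FinGraph | IsMinimalUnboundedCliqueWidth X}.Infinite ∧
    {X : Set FinGraph | IsMinimalUnboundedLinearCliqueWidth X}.Infinite ∧
    -- the witnesses, which are minimal for both parameters
    (∀ n : ℕ, IsMinimalUnboundedCliqueWidth (wordClass (zerosOneWord n)) ∧
      IsMinimalUnboundedLinearCliqueWidth (wordClass (zerosOneWord n))) ∧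
    -- they are pairwise distinct
    (∀ n m : ℕ, n ≠ m → wordClass (zerosOneWord n) ≠ wordClass (zerosOneWord m)) ∧
    -- the cycles that they contain or lack as induced subgraphs
    (∀ n : ℕ, (⟨2 * (n + 2), SimpleGraph.cycleGraph (2 * (n + 2))⟩ : FinGraph) ∈
      wordClass (zerosOneWord n)) ∧
    (∀ n m : ℕ, 2 ≤ n → n < m →
      (⟨2 * (n + 2), SimpleGraph.cycleGraph (2 * (n + 2))⟩ : FinGraph) ∉
        wordClass (zerosOneWord m)) := by
  refine ⟨?_, ?_, ?_, ?_, cycleGraph_mem_wordClass, ?_⟩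
  · exact (Set.infinite_range_of_injective wordClass_zerosOneWord_injective).mono
      (Set.range_subset_iff.2 isMinimalUnboundedCliqueWidth_wordClass)
  · exact (Set.infinite_range_of_injective wordClass_zerosOneWord_injective).mono
      (Set.range_subset_iff.2 isMinimalUnboundedLinearCliqueWidth_wordClass)
  · exact fun n => ⟨isMinimalUnboundedCliqueWidth_wordClass n,
      isMinimalUnboundedLinearCliqueWidth_wordClass n⟩
  · exact fun n m hne h => hne (wordClass_zerosOneWord_injective h)
  · exact fun n m hn hnm => cycleGraph_notMem_wordClass (by omega) (by omega)
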